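/- Let $\mathsf{ZFA}$ be $\mathsf{ZFC}$ with the Axiom of Foundation replaced by the Anti-Foundation Axiom: every flat system of equations has a unique solution. Here a flat system consists of a set $X$ of indeterminates, a set $A$, and an equation $x=S_x$ with $S_x\subseteq X\cup A$ for each $x\in X$; a solution is a function $f$ on $X$ such that every equation becomes true after each $y\in X$ is replaced by $f(y)$. For a model $M$ of $\mathsf{ZFA}$ let $M_1$ (the double-membership graph of $M$) be the structure with the same domain in the language $L_1=\{D\}$, where $D(x,y)$ holds if and only if $M\models x\in y\wedge y\in x$. For an $L_1$-sentence $\phi$ let $\mu(\phi)$ be the $L_1$-sentence $\exists x\,(\neg D(x,x)\wedge\chi(x))$, where $x$ is a variable not appearing in $\phi$ and $\chi(x)$ is obtained from $\phi$ by relativising all quantifiers $\exists y,\forall y$ to $D(x,y)$. Let $\Phi$ be the set of $L_1$-sentences which imply $\forall x\forall y\,(D(x,y)\to D(y,x))$. For a sentence $\phi$ (of the metatheory) in a finite first-order language $L'$, the consistency statement $M\models\mathrm{Con}(\phi)$ means that, in the sense of $M$, $\phi$ has a model: there is a nonempty $L'$-structure satisfying $\phi$ whose domain, relations and functions are sets of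 $M$. Theorem. Let $M$ and $N$ be models of $\mathsf{ZFA}$. The following are equivalent. 1. $M_1\equiv N_1$ (elementary equivalence of $L_1$-structures). 2. For every $\phi\in\Phi$: $M_1\models\mu(\phi)$ if and only if $N_1\models\mu(\phi)$. 3. $M$ and $N$ satisfy the same consistency statements: for every finite first-order language $L'$ and every $L'$-sentence $\phi$, $M\models\mathrm{Con}(\phi)$ if and only if $N\models\mathrm{Con}(\phi)$. -/

import Mathlib

open FirstOrder

namespace ZFA

/-! ### Structures for the language of set theory -/

/-- The only symbol of the language of set theory: a binary relation symbol for membership. -/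
inductive MemRel : ℕ → Type
  | mem : MemRel 2

/-- The language of set theory. -/
def memLang : FirstOrder.Language.{0, 0} := ⟨fun _ => Empty, MemRel⟩

section Internal

variable {M : Type*} [memLang.Structure M]

/-- `mem x y` says that `x` is an element of `y` in the sense of the structure `M`. -/
def mem (x y : M) : Prop := FirstOrder.Language.Structure.RelMap (L := memLang) MemRel.mem ![x, y]

/-- `p` is the unordered pair `{x, y}` in the sense of `M`. -/
def IsUnorderedPair (x y p : M) : Prop := ∀ z, mem z p ↔ z = x ∨ z = y

/-- `p` is the Kuratowski pair `{{x, x}, {x, y}}` in the sense of `M`. -/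
def IsPair (x y p : M) : Prop :=
  ∃ s t, IsUnorderedPair x x s ∧ IsUnorderedPair x y t ∧ IsUnorderedPair s t p

/-- `t` is the `n`-tuple with entries `v 0, …, v (n - 1)` in the sense of `M`. The empty tuple is
the empty set and a nonempty tuple is the pair of its first entry and the tuple of the others. -/
def IsTuple : {n : ℕ} → (Fin n → M) → M → Prop
  | 0, _, t => ∀ z, ¬ mem z t
  | _ + 1, v, t => ∃ s, IsTuple (Fin.tail v) s ∧ IsPair (v 0) s t

/-- `f x = y`, where `f` is a set of pairs in the sense of `M`. -/
def MapsTo (f x y : M) : Prop := ∃ p, IsPair x y p ∧ mem p f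

/-- `f` is a function with domain `X` in the sense of `M`. -/
def IsFunctionOn (f X : M) : Prop :=
  (∀ p, mem p f → ∃ x y, mem x X ∧ IsPair x y p) ∧ ∀ x, mem x X → ∃! y, MapsTo f x y

/-- In the sense of `M`, the function `S` is a flat system of equations `x = S x` (for `x` in `X`)
with set of indeterminates `X` and set of parameters `A`: every `S x` is a subset of `X ∪ A`. -/
def IsFlatSystem (X A S : M) : Prop :=
  IsFunctionOn S X ∧ ∀ x s z, MapsTo S x s → mem z s → mem z X ∨ mem z A

/-- In the sense of `M`, the function `f` with domain `X` solves the flat system `S`: the set `f x`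
is obtained from `S x` by replacing each indeterminate `y` in `S x` with `f y`. -/
def IsSolution (X S f : M) : Prop :=
  IsFunctionOn f X ∧ ∀ x s a, MapsTo S x s → MapsTo f x a →
    ∀ z, mem z a ↔ (∃ y, mem y s ∧ mem y X ∧ MapsTo f y z) ∨ (mem z s ∧ ¬ mem z X)

end Internal

/-- `M` is a model of `ZFA`, that is, of `ZFC` with the axiom of foundation replaced by the
anti-foundation axiom. -/
structure IsModel (M : Type*) [memLang.Structure M] : Prop where
  extensionality : ∀ x y : M, (∀ z, mem z x ↔ mem z y) → x = y
  pairing : ∀ x y : M, ∃ p, ∀ z, mem z p ↔ z = x ∨ z = y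
  union : ∀ a : M, ∃ u, ∀ z, mem z u ↔ ∃ y, mem y a ∧ mem z y
  powerset : ∀ a : M, ∃ p, ∀ z, mem z p ↔ ∀ y, mem y z → mem y a
  infinity : ∃ w : M, (∃ e, mem e w ∧ ∀ z, ¬ mem z e) ∧
    ∀ x, mem x w → ∃ s, mem s w ∧ ∀ z, mem z s ↔ mem z x ∨ z = x
  /-- Separation, for every first-order formula with parameters. -/
  separation : ∀ (n : ℕ) (φ : memLang.Formula (Fin (n + 1))) (p : Fin n → M) (a : M),
    ∃ b, ∀ x, mem x b ↔ mem x a ∧ φ.Realize (Fin.cons x p : Fin (n + 1) → M)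
  /-- Replacement, for every first-order formula with parameters. -/
  replacement : ∀ (n : ℕ) (φ : memLang.Formula (Fin (n + 2))) (p : Fin n → M) (a : M),
    (∀ x, mem x a → ∃! y, φ.Realize (Fin.cons x (Fin.cons y p) : Fin (n + 2) → M)) →
    ∃ b, ∀ y, mem y b ↔
      ∃ x, mem x a ∧ φ.Realize (Fin.cons x (Fin.cons y p) : Fin (n + 2) → M)
  /-- Choice: a set of nonempty pairwise disjoint sets has a transversal. -/
  choice : ∀ a : M, (∀ x, mem x a → ∃ z, mem z x) →
    (∀ x y, mem x a → mem y a → x ≠ y → ∀ z, ¬ (mem z x ∧ mem z y)) →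
    ∃ c, ∀ x, mem x a → ∃! z, mem z x ∧ mem z c
  /-- Anti-foundation: every flat system of equations has a unique solution. -/
  antifoundation : ∀ X A S : M, IsFlatSystem X A S → ∃! f, IsSolution X S f

/-! ### Double-membership graphs and the sentences `μ(φ)` -/

/-- The domain of the double-membership graph of `M`. -/
def DGraph (M : Type*) : Type _ := M

/-- The double-membership graph of `M`: the points `x` and `y` are related when each of them is an
element of the other. It is a structure for the language with one binary relation symbol; loops are
allowed. -/
instance (M : Type*) [memLang.Structure M] : FirstOrder.Language.graph.Structure (DGraph M) where
  funMap := Empty.elim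
  RelMap {_} r := match r with
    | .adj => fun v => mem (M := M) (v 0) (v 1) ∧ mem (M := M) (v 1) (v 0)

/-- The formula `χ` obtained from `φ` by relativising all quantifiers to the neighbours of a new
variable. The new variable has index `0`, and the old indices are shifted by one. -/
def relativize : {n : ℕ} → FirstOrder.Language.graph.BoundedFormula Empty n →
    FirstOrder.Language.graph.BoundedFormula Empty (n + 1)
  | _, .falsum => .falsum
  | _, .equal s t => .equal (s.relabel (Sum.map id Fin.succ)) (t.relabel (Sum.map id Fin.succ))
  | _, .rel R ts => .rel R fun i => (ts i).relabel (Sum.map id Fin.succ)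
  | _, .imp φ ψ => .imp (relativize φ) (relativize ψ)
  | n, .all φ =>
      .all (.imp (FirstOrder.Language.adj.boundedFormula₂ (.var (.inr 0)) (.var (.inr (Fin.last (n + 1)))))
        (relativize φ))

/-- The sentence `μ(φ)`: there is a point `x` without a loop such that the set of neighbours of `x`
satisfies `φ`. -/
def mu (φ : FirstOrder.Language.graph.Sentence) : FirstOrder.Language.graph.Sentence :=
  FirstOrder.Language.BoundedFormula.ex
    (∼(FirstOrder.Language.adj.boundedFormula₂ (.var (.inr 0)) (.var (.inr 0)) : FirstOrder.Language.graph.BoundedFormula Empty 1)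
      ⊓ relativize φ)

/-- The set `Φ` of the sentences that imply that the binary relation is symmetric. -/
def Phi : Set FirstOrder.Language.graph.Sentence :=
  {φ | ({φ} : FirstOrder.Language.graph.Theory) ⊨ᵇ (FirstOrder.Language.adj.symmetric : FirstOrder.Language.graph.Sentence)}

/-! ### Consistency statements -/

section Consistency

variable {M : Type*} [memLang.Structure M]

/-- The relation `R` on (the extension of) the set `a` of `M` is itself a set of `M`: some `r` in
`M` has as its elements exactly the tuples, in the sense of `M`, that satisfy `R`. -/
def IsInternalRel (a : M) {n : ℕ} (R : (Fin n → {b : M // mem b a}) → Prop) : Prop :=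
  ∃ r : M, ∀ t, mem t r ↔ ∃ v : Fin n → {b : M // mem b a}, R v ∧ IsTuple (fun i => (v i : M)) t

/-- `S` is a structure in the sense of `M` with domain `a`: the interpretations of all the symbols,
with functions seen as their graphs, are sets of `M`. -/
def IsInternalStructure {L : FirstOrder.Language.{0, 0}} (a : M) (S : L.Structure {b : M // mem b a}) : Prop :=
  (∀ (n : ℕ) (R : L.Relations n), IsInternalRel a fun v => S.RelMap R v) ∧
  ∀ (n : ℕ) (f : L.Functions n),
    IsInternalRel a fun v : Fin (n + 1) → {b : M // mem b a} => S.funMap f (Fin.tail v) = v 0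

end Consistency

/-- The consistency statement `Con(φ)` holds in `M`: in the sense of `M`, there is a nonempty
structure that satisfies `φ`. As `φ` is a formula of the metatheory, its satisfaction in a structure
of `M` means the same in `M` and in the metatheory. -/
def ModelsCon (M : Type*) [memLang.Structure M] {L : FirstOrder.Language.{0, 0}} (φ : L.Sentence) : Prop :=
  ∃ (a : M) (S : L.Structure {b : M // mem b a}),
    (∃ b, mem b a) ∧ IsInternalStructure a S ∧ φ.Realize {b : M // mem b a}

end ZFA

/-!
The implication from elementary equivalence to agreement on the sentences `μ(φ)` is immediate. The
other two implications rest on one use of anti-foundation, `ZFA.IsModel.exists_realization`: every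
graph (symmetric, loops allowed) that is definable on a set of the model is isomorphic to a union of
connected components of the double-membership graph, and these components can be chosen disjoint
from any given set. The vertex `x` becomes the solution of `x = {y | y adjacent to x} ∪ {l x}`,
where the label `l x` makes the solutions distinct without adding double memberships.

From `μ(φ)` to consistency statements: the neighbours of a point form a set, so that a definable
structure on them is a structure in the sense of the model. For an arbitrary finite language, a
sentence `φ` is translated into a sentence `graphSentence φ` in `Φ`, which says that a symmetric
graph codes a model of `φ`. In such a graph the elements of the domain are the vertices with a loop.
A tuple satisfying a symbol is coded by a vertex and by further vertices joining it to its entries,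
and the kinds of these vertices are marked by hubs. Then `φ` is consistent in `M` if and only if
`μ(graphSentence φ)` holds in the double-membership graph. In one direction
(`ZFA.IsModel.mu_of_modelsCon`) the graph coding a model, with an apex adjacent to all its vertices,
is realized by anti-foundation; in the other (`ZFA.IsModel.modelsCon_of_mu`) the structure coded in
the neighbourhood of a point is definable.

From consistency statements to elementary equivalence: Duplicator wins the Ehrenfeucht–Fraïssé game
of every length `k` on the two double-membership graphs (`ZFA.IsModel.backForth_univ`). All points
chosen so far lie in two sets closed under double membership, on which Duplicator has a winning
strategy for the remaining rounds. A new point `c` outside of such a set lies in another one,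
disjoint from it, since every point lies in a transitive set (`ZFA.IsModel.exists_transitive`). The
type of rank `k` of `c` in that graph is described by a Hintikka sentence, which is consistent in
one model, hence in the other, where its model is realized by a union of components disjoint from
all points chosen so far. The strategies on disjoint unions of components combine
(`ZFA.BackForth.union`).

Sets of the model are obtained from instances of separation and replacement. To apply these, the
definability of a predicate is derived by instance search from the way it is written, through the
class `ZFA.DefinablePred`.
-/

namespace ZFA

/-! ### Definability with parameters -/

section Definability

universe u

variable {M : Type u} [memLang.Structure M] {α β : Type}

/-- The predicate `P` on assignments of the variables in `α` is first-order definable in `M` with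
parameters from `M`: the variables of the defining formula are those in `α`, together with one
variable for each element of `M`, which stands for that element. This is a class, so that the
definability of an explicitly written predicate is found by instance search. -/
class DefinablePred (P : (α → M) → Prop) : Prop where
  exists_formula : ∃ φ : memLang.Formula (α ⊕ M), ∀ v, φ.Realize (Sum.elim v id) ↔ P v

/-- The function `f` on assignments of the variables in `α` is first-order definable in `M` with
parameters: its graph is, the value being the variable `none`. -/
class DefinableFun (f : (α → M) → M) : Prop where
  graph : DefinablePred fun w : Option α → M => w none = f fun i => w (some i)

theorem DefinablePred.congr (P : (α → M) → Prop) {Q : (α → M) → Prop} [h : DefinablePred P]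
    (hPQ : ∀ v, P v ↔ Q v) : DefinablePred Q := by
  obtain rfl : P = Q := funext fun v => propext (hPQ v)
  exact h

theorem DefinablePred.comp {P : (α → M) → Prop} (h : DefinablePred P) (σ : α → β) :
    DefinablePred fun v : β → M => P fun i => v (σ i) := by
  obtain ⟨φ, hφ⟩ := h
  refine ⟨φ.relabel (Sum.map σ id), fun v => ?_⟩
  rw [Language.Formula.realize_relabel, ← hφ]
  refine iff_of_eq (congrArg _ (funext ?_))
  rintro (i | m) <;> rfl

instance : DefinablePred fun _ : α → M => True := ⟨⊤, fun v => by simp⟩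

instance : DefinablePred fun _ : α → M => False := ⟨⊥, fun v => by simp [Language.Formula.Realize]⟩

instance {P : (α → M) → Prop} [hP : DefinablePred P] : DefinablePred fun v => ¬ P v := by
  obtain ⟨φ, hφ⟩ := hP
  exact ⟨φ.not, fun v => by rw [Language.Formula.realize_not, hφ]⟩

instance {P Q : (α → M) → Prop} [hP : DefinablePred P] [hQ : DefinablePred Q] :
    DefinablePred fun v => P v ∧ Q v := by
  obtain ⟨φ, hφ⟩ := hP
  obtain ⟨ψ, hψ⟩ := hQ
  exact ⟨φ ⊓ ψ, fun v => by rw [Language.Formula.realize_inf, hφ, hψ]⟩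

instance {P Q : (α → M) → Prop} [DefinablePred P] [DefinablePred Q] :
    DefinablePred fun v => P v ∨ Q v :=
  .congr (fun v : α → M => ¬ (¬ P v ∧ ¬ Q v)) fun v => by tauto

instance {P Q : (α → M) → Prop} [DefinablePred P] [DefinablePred Q] :
    DefinablePred fun v => P v → Q v :=
  .congr (fun v : α → M => ¬ P v ∨ Q v) fun v => by tauto

instance {P Q : (α → M) → Prop} [DefinablePred P] [DefinablePred Q] :
    DefinablePred fun v => P v ↔ Q v :=
  .congr (fun v : α → M => (P v → Q v) ∧ (Q v → P v)) fun v => by tauto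

instance {P : (α → M) → M → Prop}
    [h : DefinablePred fun w : Option α → M => P (fun i => w (some i)) (w none)] :
    DefinablePred fun v => ∃ x, P v x := by
  obtain ⟨φ, hφ⟩ := h
  refine ⟨(φ.relabel (Sum.elim (fun o => o.elim (.inr ()) fun i => .inl (.inl i))
    fun m => .inl (.inr m)) : memLang.Formula ((α ⊕ M) ⊕ Unit)).iExs Unit, fun v => ?_⟩
  rw [Language.Formula.realize_iExs]
  have key : ∀ x : Unit → M, (φ.relabel (Sum.elim (fun o => o.elim (.inr ()) fun i => .inl (.inl i))
    fun m => .inl (.inr m)) : memLang.Formula ((α ⊕ M) ⊕ Unit)).Realize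
      (Sum.elim (Sum.elim v id) x) ↔ P v (x ()) := by
    intro x
    rw [Language.Formula.realize_relabel]
    refine (iff_of_eq (congrArg _ (funext ?_))).trans (hφ fun o => o.elim (x ()) v)
    rintro ((_ | i) | m) <;> rfl
  exact ⟨fun ⟨x, hx⟩ => ⟨x (), (key x).1 hx⟩, fun ⟨x, hx⟩ => ⟨fun _ => x, (key _).2 hx⟩⟩

instance {P : (α → M) → M → Prop}
    [DefinablePred fun w : Option α → M => P (fun i => w (some i)) (w none)] :
    DefinablePred fun v => ∀ x, P v x :=
  .congr (fun v : α → M => ¬ ∃ x, ¬ P v x) fun v => by simp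

instance {ι : Type} [Finite ι] {P : (α → M) → (ι → M) → Prop}
    [h : DefinablePred fun w : α ⊕ ι → M => P (fun i => w (.inl i)) (fun i => w (.inr i))] :
    DefinablePred fun v => ∃ x : ι → M, P v x := by
  obtain ⟨φ, hφ⟩ := h
  refine ⟨(φ.relabel (Sum.elim (Sum.elim (fun i => .inl (.inl i)) .inr)
    fun m => .inl (.inr m)) : memLang.Formula ((α ⊕ M) ⊕ ι)).iExs ι, fun v => ?_⟩
  rw [Language.Formula.realize_iExs]
  refine exists_congr fun x => ?_
  rw [Language.Formula.realize_relabel]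
  refine (iff_of_eq (congrArg _ (funext ?_))).trans (hφ (Sum.elim v x))
  rintro ((_ | i) | m) <;> rfl

instance {ι : Type} [Finite ι] {P : ι → (α → M) → Prop} [h : ∀ i, DefinablePred (P i)] :
    DefinablePred fun v => ∃ i : ι, P i v := by
  choose φ hφ using fun i => (h i).exists_formula
  exact ⟨Language.Formula.iSup φ, fun v => by simp only [Language.Formula.realize_iSup, hφ]⟩

instance {ι : Type} [Finite ι] {P : ι → (α → M) → Prop} [∀ i, DefinablePred (P i)] :
    DefinablePred fun v => ∀ i : ι, P i v :=
  .congr (fun v : α → M => ¬ ∃ i, ¬ P i v) fun v => by simp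

theorem definablePred_var_eq (i j : α) : DefinablePred fun v : α → M => v i = v j :=
  ⟨(Language.Term.var (.inl i)).equal (.var (.inl j)), fun v => by
    simp [Language.Formula.realize_equal]⟩

theorem definablePred_var_mem (i j : α) : DefinablePred fun v : α → M => mem (v i) (v j) :=
  ⟨Language.Relations.formula₂ (L := memLang) MemRel.mem (.var (.inl i)) (.var (.inl j)),
    fun _ => Language.Formula.realize_rel₂⟩

instance (i : α) : DefinableFun fun v : α → M => v i := ⟨definablePred_var_eq _ _⟩

instance (c : M) : DefinableFun fun _ : α → M => c :=
  ⟨(Language.Term.var (.inl none)).equal (.var (.inr c)), fun v => by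
    simp [Language.Formula.realize_equal]⟩

instance (priority := low) {f : (α → M) → M} [h : DefinableFun f] (σ : α → β) :
    DefinableFun fun w : β → M => f fun i => w (σ i) :=
  ⟨h.graph.comp (Option.map σ)⟩

theorem DefinablePred.subst (P : (α → M) → M → Prop) {f : (α → M) → M}
    (hP : DefinablePred fun w : Option α → M => P (fun i => w (some i)) (w none))
    [hf : DefinableFun f] : DefinablePred fun v => P v (f v) := by
  have := hf.graph
  exact .congr (fun v : α → M => ∃ x, x = f v ∧ P v x) fun v => by simp

instance {f g : (α → M) → M} [DefinableFun f] [DefinableFun g] :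
    DefinablePred fun v => mem (f v) (g v) :=
  DefinablePred.subst (fun v x => mem (f v) x) <|
    DefinablePred.subst (fun w x => mem x (w none)) <| definablePred_var_mem _ _

instance {f g : (α → M) → M} [DefinableFun f] [DefinableFun g] :
    DefinablePred fun v => f v = g v :=
  DefinablePred.subst (fun v x => f v = x) <|
    DefinablePred.subst (fun w x => x = w none) <| definablePred_var_eq _ _

instance {f g h : (α → M) → M} [DefinableFun f] [DefinableFun g] [DefinableFun h] :
    DefinablePred fun v => IsUnorderedPair (f v) (g v) (h v) := by
  unfold IsUnorderedPair
  infer_instance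

instance {f g h : (α → M) → M} [DefinableFun f] [DefinableFun g] [DefinableFun h] :
    DefinablePred fun v => IsPair (f v) (g v) (h v) := by
  unfold IsPair
  infer_instance

/-- A definable predicate in `n` variables is defined by a formula with finitely many further
variables for parameters. -/
theorem DefinablePred.exists_formula_fin {n : ℕ} {P : (Fin n → M) → Prop} (h : DefinablePred P) :
    ∃ (k : ℕ) (φ : memLang.Formula (Fin n ⊕ Fin k)) (p : Fin k → M),
      ∀ v, φ.Realize (Sum.elim v p) ↔ P v := by
  classical
  obtain ⟨φ, hφ⟩ := h
  obtain ⟨s, hs⟩ : ∃ s : Finset M, ∀ m, .inr m ∈ φ.freeVarFinset → m ∈ s :=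
    ⟨φ.freeVarFinset.preimage Sum.inr Sum.inr_injective.injOn, fun m hm => by simpa using hm⟩
  refine ⟨s.card, φ.restrictFreeVar fun i => match i with
    | ⟨.inl i, _⟩ => .inl i
    | ⟨.inr m, hm⟩ => .inr (s.equivFin ⟨m, hs m hm⟩), fun i => (s.equivFin.symm i : M), fun v => ?_⟩
  rw [← hφ]
  refine Language.BoundedFormula.realize_restrictFreeVar _ ?_
  rintro ⟨i | m, hm⟩ <;> simp

variable (hM : IsModel M)
include hM

theorem IsModel.exists_sep (a : M) (P : M → Prop) [h : DefinablePred fun v : Fin 1 → M => P (v 0)] :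
    ∃ b, ∀ x, mem x b ↔ mem x a ∧ P x := by
  obtain ⟨k, φ, p, hφ⟩ := h.exists_formula_fin
  obtain ⟨b, hb⟩ := hM.separation k (φ.relabel (Sum.elim (fun _ => 0) Fin.succ)) p a
  refine ⟨b, fun x => ?_⟩
  rw [hb, Language.Formula.realize_relabel, ← hφ fun _ => x]
  refine and_congr_right fun _ => iff_of_eq (congrArg _ (funext ?_))
  rintro (i | i) <;> simp

theorem IsModel.exists_repl (a : M) (F : M → M → Prop)
    [h : DefinablePred fun v : Fin 2 → M => F (v 0) (v 1)]
    (hF : ∀ x, mem x a → ∃! y, F x y) : ∃ b, ∀ y, mem y b ↔ ∃ x, mem x a ∧ F x y := by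
  obtain ⟨k, φ, p, hφ⟩ := h.exists_formula_fin
  have key : ∀ x y, (φ.relabel (Sum.elim (fun i => Fin.cases 0 (fun _ => 1) i)
      fun i => i.succ.succ)).Realize (Fin.cons x (Fin.cons y p) : Fin (k + 2) → M) ↔ F x y := by
    intro x y
    rw [Language.Formula.realize_relabel]
    refine (iff_of_eq (congrArg _ (funext ?_))).trans (hφ ![x, y])
    rintro (i | i)
    · fin_cases i <;> rfl
    · rfl
  obtain ⟨b, hb⟩ := hM.replacement k _ p a fun x hx => (existsUnique_congr (key x)).2 (hF x hx)
  exact ⟨b, fun y => by simp only [hb, key]⟩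

end Definability

/-! ### Pairs, tuples and finite families -/

section SetTheory

universe u

variable {M : Type u} [memLang.Structure M]

namespace IsModel

variable (hM : IsModel M)

/-- The unordered pair `{x, y}` of a model. -/
noncomputable def upair (x y : M) : M := (hM.pairing x y).choose

/-- The Kuratowski pair of a model. -/
noncomputable def pair (x y : M) : M := hM.upair (hM.upair x x) (hM.upair x y)

theorem mem_upair {x y z : M} : mem z (hM.upair x y) ↔ z = x ∨ z = y :=
  (hM.pairing x y).choose_spec z

theorem isUnorderedPair_iff {x y p : M} : IsUnorderedPair x y p ↔ p = hM.upair x y := by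
  refine ⟨fun h => hM.extensionality _ _ fun z => (h z).trans hM.mem_upair.symm, ?_⟩
  rintro rfl z
  exact hM.mem_upair

theorem isPair_iff {x y p : M} : IsPair x y p ↔ p = hM.pair x y := by
  simp [IsPair, hM.isUnorderedPair_iff, pair]

theorem mapsTo_iff {f x y : M} : MapsTo f x y ↔ mem (hM.pair x y) f := by
  simp [MapsTo, hM.isPair_iff]

theorem upair_eq_upair_iff {x y x' y' : M} :
    hM.upair x y = hM.upair x' y' ↔ x = x' ∧ y = y' ∨ x = y' ∧ y = x' := by
  constructor
  · intro h
    have key : ∀ z, (z = x ∨ z = y) ↔ (z = x' ∨ z = y') := fun z => by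
      rw [← hM.mem_upair, ← hM.mem_upair, h]
    have h1 := key x
    have h2 := key y
    have h3 := key x'
    have h4 := key y'
    grind
  · rintro (⟨rfl, rfl⟩ | ⟨rfl, rfl⟩)
    · rfl
    · exact hM.extensionality _ _ fun z => by rw [hM.mem_upair, hM.mem_upair, or_comm]

theorem pair_eq_pair_iff {x y x' y' : M} :
    hM.pair x y = hM.pair x' y' ↔ x = x' ∧ y = y' := by
  simp only [pair, hM.upair_eq_upair_iff]
  grind

instance {α : Type} {f g : (α → M) → M} [DefinableFun f] [DefinableFun g] :
    DefinableFun fun v => hM.upair (f v) (g v) :=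
  ⟨.congr (fun w : Option α → M => IsUnorderedPair (f fun i => w (some i)) (g fun i => w (some i))
    (w none)) fun _ => hM.isUnorderedPair_iff⟩

instance {α : Type} {f g : (α → M) → M} [DefinableFun f] [DefinableFun g] :
    DefinableFun fun v => hM.pair (f v) (g v) := by
  unfold pair
  infer_instance

include hM in
theorem exists_empty : ∃ e : M, ∀ z, ¬ mem z e := by
  obtain ⟨_, ⟨e, _, he⟩, _⟩ := hM.infinity
  exact ⟨e, he⟩

/-- The empty set of a model. -/
noncomputable def empty : M := hM.exists_empty.choose

theorem not_mem_empty (z : M) : ¬ mem z hM.empty := hM.exists_empty.choose_spec z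

theorem eq_empty_iff {x : M} : x = hM.empty ↔ ∀ z, ¬ mem z x := by
  constructor
  · rintro rfl
    exact hM.not_mem_empty
  · exact fun h => hM.extensionality _ _ fun z =>
      ⟨fun hz => (h z hz).elim, fun hz => (hM.not_mem_empty z hz).elim⟩

include hM in
theorem exists_union (a b : M) : ∃ c, ∀ z, mem z c ↔ mem z a ∨ mem z b := by
  obtain ⟨c, hc⟩ := hM.union (hM.upair a b)
  exact ⟨c, fun z => by simp [hc, hM.mem_upair, or_and_right, exists_or]⟩

include hM in
theorem exists_insert (a x : M) : ∃ c, ∀ z, mem z c ↔ mem z a ∨ z = x := by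
  obtain ⟨c, hc⟩ := hM.exists_union a (hM.upair x x)
  exact ⟨c, fun z => by simp [hc, hM.mem_upair]⟩

include hM in
/-- The values of a definable function on a set form a set. -/
theorem exists_image (a : M) (F : M → M) [h : DefinablePred fun v : Fin 2 → M => v 1 = F (v 0)] :
    ∃ b, ∀ y, mem y b ↔ ∃ x, mem x a ∧ y = F x :=
  hM.exists_repl a (fun x y => y = F x) fun _ _ => existsUnique_eq

include hM in
theorem exists_range {ι : Type*} [Finite ι] (A : ι → M) : ∃ s, ∀ z, mem z s ↔ ∃ i, z = A i := by
  suffices ∀ t : Set ι, t.Finite → ∃ s, ∀ z, mem z s ↔ ∃ i ∈ t, z = A i by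
    simpa using this Set.univ Set.finite_univ
  intro t ht
  induction t, ht using Set.Finite.induction_on with
  | empty => simpa using hM.exists_empty
  | @insert i t _ _ ih =>
    obtain ⟨s, hs⟩ := ih
    obtain ⟨s', hs'⟩ := hM.exists_insert s (A i)
    exact ⟨s', fun z => by simp [hs, hs', or_comm]⟩

include hM in
theorem exists_prod (a b : M) :
    ∃ c, ∀ z, mem z c ↔ ∃ x y, mem x a ∧ mem y b ∧ z = hM.pair x y := by
  have h1 : ∀ x, ∃ c, ∀ z, mem z c ↔ ∃ y, mem y b ∧ z = hM.pair x y := fun x =>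
    hM.exists_image b (hM.pair x)
  obtain ⟨d, hd⟩ := hM.exists_repl a
    (fun x c => ∀ z, mem z c ↔ ∃ y, mem y b ∧ z = hM.pair x y) fun x _ => by
      obtain ⟨c, hc⟩ := h1 x
      exact ⟨c, hc, fun c' hc' => hM.extensionality _ _ fun z => (hc' z).trans (hc z).symm⟩
  obtain ⟨c, hc⟩ := hM.union d
  refine ⟨c, fun z => ?_⟩
  rw [hc]
  constructor
  · rintro ⟨y, hy, hz⟩
    obtain ⟨x, hx, hxy⟩ := (hd y).1 hy
    obtain ⟨y', hy', rfl⟩ := (hxy z).1 hz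
    exact ⟨x, y', hx, hy', rfl⟩
  · rintro ⟨x, y, hx, hy, rfl⟩
    obtain ⟨c', hc'⟩ := h1 x
    exact ⟨c', (hd c').2 ⟨x, hx, hc'⟩, (hc' _).2 ⟨y, hy, rfl⟩⟩

include hM in
/-- The subset of a set `c` consisting of the elements that do not belong to themselves is not an
element of `c`. -/
theorem exists_subset_not_mem (c : M) : ∃ u, (∀ z, mem z u → mem z c) ∧ ¬ mem u c := by
  obtain ⟨u, hu⟩ := hM.exists_sep c fun z => ¬ mem z z
  have := hu u
  exact ⟨u, fun z hz => ((hu z).1 hz).1, by tauto⟩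

include hM in
theorem infinite : Infinite M := by
  refine ⟨fun h => ?_⟩
  obtain ⟨s, hs⟩ := hM.exists_range (fun x : M => x)
  obtain ⟨u, -, hu⟩ := hM.exists_subset_not_mem s
  exact hu ((hs u).2 ⟨u, rfl⟩)

/-- The tuple of a model with the entries `v 0, …, v (n - 1)`. -/
noncomputable def tuple : {n : ℕ} → (Fin n → M) → M
  | 0, _ => hM.empty
  | _ + 1, v => hM.pair (v 0) (tuple (Fin.tail v))

theorem isTuple_iff {n : ℕ} {v : Fin n → M} {t : M} : IsTuple v t ↔ t = hM.tuple v := by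
  induction n generalizing t with
  | zero => exact hM.eq_empty_iff.symm
  | succ n ih => simp [IsTuple, tuple, ih, hM.isPair_iff]

theorem tuple_injective {n : ℕ} : Function.Injective (hM.tuple : (Fin n → M) → M) := by
  induction n with
  | zero => exact fun _ _ _ => Subsingleton.elim _ _
  | succ n ih =>
    intro v w h
    obtain ⟨h0, h1⟩ := hM.pair_eq_pair_iff.1 h
    rw [← Fin.cons_self_tail v, ← Fin.cons_self_tail w, h0, ih h1]

instance {α : Type} {n : ℕ} {f : (α → M) → Fin n → M} [h : ∀ i, DefinableFun fun v => f v i] :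
    DefinableFun fun v => hM.tuple (f v) := by
  induction n with
  | zero => exact inferInstanceAs (DefinableFun fun _ : α → M => hM.empty)
  | succ n ih =>
    have := @ih (fun v => Fin.tail (f v)) fun i => h i.succ
    exact inferInstanceAs (DefinableFun fun v => hM.pair (f v 0) (hM.tuple (Fin.tail (f v))))

include hM in
theorem exists_tuples (a : M) (n : ℕ) :
    ∃ b, ∀ t, mem t b ↔ ∃ v : Fin n → M, (∀ i, mem (v i) a) ∧ t = hM.tuple v := by
  induction n with
  | zero => exact ⟨hM.upair hM.empty hM.empty, fun t => by simp [hM.mem_upair, tuple]⟩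
  | succ n ih =>
    obtain ⟨b, hb⟩ := ih
    obtain ⟨c, hc⟩ := hM.exists_prod a b
    refine ⟨c, fun t => (hc t).trans ⟨?_, ?_⟩⟩
    · rintro ⟨x, s, hx, hs, rfl⟩
      obtain ⟨v, hv, rfl⟩ := (hb s).1 hs
      exact ⟨Fin.cons x v, Fin.cases hx hv, by simp [tuple]⟩
    · rintro ⟨v, hv, rfl⟩
      exact ⟨v 0, _, hv 0, (hb _).2 ⟨Fin.tail v, fun i => hv i.succ, rfl⟩, rfl⟩

include hM in
/-- A definable relation on a set is a relation in the sense of the model. -/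
theorem isInternalRel (a : M) {n : ℕ} (P : (Fin n → M) → Prop) [h : DefinablePred P] :
    IsInternalRel a fun v => P fun i => v i := by
  have : DefinablePred fun w : Fin 1 ⊕ Fin n → M => P fun i => w (.inr i) := h.comp _
  obtain ⟨b, hb⟩ := hM.exists_tuples a n
  obtain ⟨r, hr⟩ := hM.exists_sep b fun t => ∃ v : Fin n → M, P v ∧ t = hM.tuple v
  refine ⟨r, fun t => ?_⟩
  simp only [hr, hb, hM.isTuple_iff]
  constructor
  · rintro ⟨⟨v, hv, rfl⟩, w, hw, h⟩
    obtain rfl := hM.tuple_injective h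
    exact ⟨fun i => ⟨v i, hv i⟩, hw, rfl⟩
  · rintro ⟨v, hv, rfl⟩
    exact ⟨⟨_, fun i => (v i).2, rfl⟩, _, hv, rfl⟩

/-! ### Transitive sets -/

/-- `hM.IsCertificate a f` says that every pair `⟨k, p⟩` in `f` has `p = a`, or else `p` is an
element of some `q` with `⟨j, q⟩` in `f` for an element `j` of `k`. If such an `f` contains
`⟨n, y⟩`, where `n` is a natural number of the model, then `y` is reached from `a` in at most `n`
steps, each of which goes from a set to one of its elements. -/
def IsCertificate (a f : M) : Prop :=
  ∀ k p, mem (hM.pair k p) f → p = a ∨ ∃ j q, mem j k ∧ mem (hM.pair j q) f ∧ mem p q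

instance {α : Type} {f g : (α → M) → M} [DefinableFun f] [DefinableFun g] :
    DefinablePred fun v => hM.IsCertificate (f v) (g v) := by
  unfold IsCertificate
  infer_instance

/-- `y` is reached from `a` in at most `n` steps. -/
def Reached (a n y : M) : Prop := ∃ f, hM.IsCertificate a f ∧ mem (hM.pair n y) f

instance {α : Type} {f g h : (α → M) → M} [DefinableFun f] [DefinableFun g] [DefinableFun h] :
    DefinablePred fun v => hM.Reached (f v) (g v) (h v) := by
  unfold Reached
  infer_instance

theorem reached_iff {a n y : M} :
    hM.Reached a n y ↔ y = a ∨ ∃ j q, mem j n ∧ hM.Reached a j q ∧ mem y q := by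
  constructor
  · rintro ⟨f, hf, hy⟩
    refine (hf n y hy).imp_right ?_
    rintro ⟨j, q, hj, hq, hyq⟩
    exact ⟨j, q, hj, ⟨f, hf, hq⟩, hyq⟩
  · rintro (rfl | ⟨j, q, hj, ⟨f, hf, hq⟩, hyq⟩)
    · refine ⟨hM.upair (hM.pair n y) (hM.pair n y), fun k p h => .inl ?_, hM.mem_upair.2 (.inl rfl)⟩
      rw [hM.mem_upair, or_self, hM.pair_eq_pair_iff] at h
      exact h.2
    · obtain ⟨g, hg⟩ := hM.exists_insert f (hM.pair n y)
      refine ⟨g, fun k p h => ?_, (hg _).2 (.inr rfl)⟩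
      rcases (hg _).1 h with h | h
      · refine (hf k p h).imp_right ?_
        rintro ⟨j, q, hj, hq, hpq⟩
        exact ⟨j, q, hj, (hg _).2 (.inl hq), hpq⟩
      · obtain ⟨rfl, rfl⟩ := hM.pair_eq_pair_iff.1 h
        exact .inr ⟨j, q, hj, (hg _).2 (.inl hq), hyq⟩

/-- If the points reached in at most `j` steps form a set for all elements `j` of `n`, then so do
the points reached in at most `j` steps for some `j` in `n`. -/
theorem exists_iUnion_reached {a n : M}
    (hn : ∀ j, mem j n → ∃ t, ∀ y, mem y t ↔ hM.Reached a j y) :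
    ∃ u, ∀ y, mem y u ↔ ∃ j, mem j n ∧ hM.Reached a j y := by
  obtain ⟨s, hs⟩ := hM.exists_repl n (fun j t => ∀ y, mem y t ↔ hM.Reached a j y) fun j hj => by
    obtain ⟨t, ht⟩ := hn j hj
    exact ⟨t, ht, fun t' ht' => hM.extensionality _ _ fun z => (ht' z).trans (ht z).symm⟩
  obtain ⟨u, hu⟩ := hM.union s
  refine ⟨u, fun y => (hu y).trans ⟨?_, ?_⟩⟩
  · rintro ⟨t, ht, hy⟩
    obtain ⟨j, hj, hjt⟩ := (hs t).1 ht
    exact ⟨j, hj, (hjt y).1 hy⟩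
  · rintro ⟨j, hj, hy⟩
    obtain ⟨t, ht⟩ := hn j hj
    exact ⟨t, (hs t).2 ⟨j, hj, ht⟩, (ht y).2 hy⟩

include hM in
/-- Every point of a model is an element of a transitive set. -/
theorem exists_transitive (a : M) : ∃ T, mem a T ∧ ∀ x y, mem x T → mem y x → mem y T := by
  obtain ⟨w, ⟨e, hew, he⟩, hw⟩ := hM.infinity
  -- The numbers `n` for which the levels below `n` are sets form an inductive set by replacement,
  -- so that no induction on the natural numbers of the model is needed.
  obtain ⟨w', hw'⟩ := hM.exists_sep w fun n =>
    ∀ j, mem j n → ∃ t, ∀ y, mem y t ↔ hM.Reached a j y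
  have he' : mem e w' := (hw' e).2 ⟨hew, fun j hj => (he j hj).elim⟩
  have hsucc : ∀ n, mem n w' → ∃ s, mem s w' ∧ ∀ z, mem z s ↔ mem z n ∨ z = n := by
    intro n hn
    obtain ⟨hnw, hn⟩ := (hw' n).1 hn
    obtain ⟨s, hsw, hs⟩ := hw n hnw
    refine ⟨s, (hw' s).2 ⟨hsw, fun j hj => ?_⟩, hs⟩
    obtain hj | rfl := (hs j).1 hj
    · exact hn j hj
    · obtain ⟨u, hu⟩ := hM.exists_iUnion_reached hn
      obtain ⟨u', hu'⟩ := hM.union u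
      obtain ⟨t, ht⟩ := hM.exists_insert u' a
      refine ⟨t, fun y => ?_⟩
      rw [ht, hu', hM.reached_iff, or_comm]
      simp only [hu]
      exact or_congr_right ⟨fun ⟨q, ⟨j, hj, hq⟩, hy⟩ => ⟨j, q, hj, hq, hy⟩,
        fun ⟨j, q, hj, hq, hy⟩ => ⟨q, ⟨j, hj, hq⟩, hy⟩⟩
  obtain ⟨T, hT⟩ := hM.exists_iUnion_reached (a := a) (n := w') fun n hn => by
    obtain ⟨s, hs, hns⟩ := hsucc n hn
    exact ((hw' s).1 hs).2 n ((hns n).2 (.inr rfl))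
  refine ⟨T, (hT a).2 ⟨e, he', hM.reached_iff.2 (.inl rfl)⟩, fun x y hx hy => ?_⟩
  obtain ⟨n, hn, hnx⟩ := (hT x).1 hx
  obtain ⟨s, hs, hns⟩ := hsucc n hn
  exact (hT y).2 ⟨s, hs, hM.reached_iff.2 (.inr ⟨n, x, (hns n).2 (.inr rfl), hnx, hy⟩)⟩

/-! ### Realizing graphs by anti-foundation -/

include hM in
/-- Anti-foundation for systems given by a definable relation: if no `l x` is an indeterminate, the
system of equations `x = {y | r x y} ∪ {l x}` for `x` in `V` has a solution. -/
theorem exists_solution (V : M) (r : M → M → Prop) (l : M → M)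
    [hr : ∀ {α : Type} (f g : (α → M) → M) [DefinableFun f] [DefinableFun g],
      DefinablePred fun v => r (f v) (g v)]
    [hl : ∀ {α : Type} (f : (α → M) → M) [DefinableFun f], DefinableFun fun v => l (f v)]
    (hlV : ∀ x, mem x V → ¬ mem (l x) V) :
    ∃ g : M → M, (∀ x, mem x V → ∀ z, mem z (g x) ↔ (∃ y, mem y V ∧ r x y ∧ z = g y) ∨ z = l x) ∧
      ∃ C, ∀ z, mem z C ↔ ∃ x, mem x V ∧ z = g x := by
  have hS0 : ∀ x, ∃ s, ∀ z, mem z s ↔ (mem z V ∧ r x z) ∨ z = l x := fun x => by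
    obtain ⟨t, ht⟩ := hM.exists_sep V (r x)
    obtain ⟨s, hs⟩ := hM.exists_insert t (l x)
    exact ⟨s, fun z => by rw [hs, ht]⟩
  have hSuniq : ∀ x s s', (∀ z, mem z s ↔ (mem z V ∧ r x z) ∨ z = l x) →
      (∀ z, mem z s' ↔ (mem z V ∧ r x z) ∨ z = l x) → s = s' := fun x s s' hs hs' =>
    hM.extensionality _ _ fun z => (hs z).trans (hs' z).symm
  obtain ⟨A, hA⟩ := hM.exists_image V l
  obtain ⟨S, hS⟩ := hM.exists_repl V (fun x p => ∃ s, (∀ z, mem z s ↔ (mem z V ∧ r x z) ∨ z = l x) ∧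
    p = hM.pair x s) fun x _ => by
      obtain ⟨s, hs⟩ := hS0 x
      refine ⟨_, ⟨s, hs, rfl⟩, ?_⟩
      rintro _ ⟨s', hs', rfl⟩
      rw [hSuniq x s s' hs hs']
  have hSmap : ∀ x s, MapsTo S x s ↔ mem x V ∧ ∀ z, mem z s ↔ (mem z V ∧ r x z) ∨ z = l x := by
    intro x s
    rw [hM.mapsTo_iff, hS]
    constructor
    · rintro ⟨x', hx', s', hs', h⟩
      obtain ⟨rfl, rfl⟩ := hM.pair_eq_pair_iff.1 h
      exact ⟨hx', hs'⟩
    · exact fun ⟨hx, hs⟩ => ⟨x, hx, s, hs, rfl⟩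
  obtain ⟨f, ⟨⟨hfdom, hfun⟩, hf⟩, -⟩ := hM.antifoundation V A S <| by
    refine ⟨⟨fun p hp => ?_, fun x hx => ?_⟩, fun x s z hs hz => ?_⟩
    · obtain ⟨x, hx, s, -, rfl⟩ := (hS p).1 hp
      exact ⟨x, s, hx, hM.isPair_iff.2 rfl⟩
    · obtain ⟨s, hs⟩ := hS0 x
      exact ⟨s, (hSmap x s).2 ⟨hx, hs⟩, fun s' hs' => hSuniq x s' s ((hSmap x s').1 hs').2 hs⟩
    · obtain ⟨hx, hs⟩ := (hSmap x s).1 hs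
      exact ((hs z).1 hz).imp And.left fun h => (hA z).2 ⟨x, hx, h⟩
  have hg : ∀ x, ∃ y, mem x V → MapsTo f x y := fun x => by
    by_cases hx : mem x V
    · exact (hfun x hx).exists.imp fun y hy _ => hy
    · exact ⟨x, fun h => (hx h).elim⟩
  choose g hg using hg
  have hguniq : ∀ x y, mem x V → (MapsTo f x y ↔ y = g x) := fun x y hx =>
    ⟨fun h => (hfun x hx).unique h (hg x hx), by rintro rfl; exact hg x hx⟩
  refine ⟨g, fun x hx z => ?_, ?_⟩
  · obtain ⟨s, hs⟩ := hS0 x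
    rw [hf x s (g x) ((hSmap x s).2 ⟨hx, hs⟩) (hg x hx) z]
    refine or_congr ⟨?_, ?_⟩ ⟨?_, ?_⟩
    · rintro ⟨y, hy, hyV, hyz⟩
      refine ⟨y, hyV, ?_, (hguniq y z hyV).1 hyz⟩
      rcases (hs y).1 hy with h | rfl
      · exact h.2
      · exact (hlV x hx hyV).elim
    · rintro ⟨y, hy, hxy, rfl⟩
      exact ⟨y, (hs y).2 (.inl ⟨hy, hxy⟩), hy, hg y hy⟩
    · exact fun ⟨hz, hzV⟩ => ((hs z).1 hz).resolve_left fun h => hzV h.1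
    · rintro rfl
      exact ⟨(hs _).2 (.inr rfl), hlV x hx⟩
  · have : DefinablePred fun v : Fin 2 → M => MapsTo f (v 0) (v 1) := by
      unfold MapsTo
      infer_instance
    obtain ⟨C, hC⟩ := hM.exists_repl V (MapsTo f) hfun
    refine ⟨C, fun z => (hC z).trans (exists_congr fun x => and_congr_right fun hx => ?_)⟩
    exact hguniq x z hx

end IsModel

/-- The double-membership relation. -/
def DAdj (x y : M) : Prop := mem x y ∧ mem y x

theorem DAdj.symm {x y : M} (h : DAdj x y) : DAdj y x := ⟨h.2, h.1⟩

instance {α : Type} {f g : (α → M) → M} [DefinableFun f] [DefinableFun g] :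
    DefinablePred fun v => DAdj (f v) (g v) := by
  unfold DAdj
  infer_instance

/-- Every symmetric definable relation on a set `V` is realized by the double-membership relation on
a set that is closed under double membership and disjoint from a given set `B`. The point that
realizes `x` solves the equation `x = {y | r x y} ∪ {l x}`, where the label `l x` makes the solution
injective and does not contribute to double membership. -/
theorem IsModel.exists_realization (hM : IsModel M) (V B : M) (r : M → M → Prop)
    [hr : ∀ {α : Type} (f g : (α → M) → M) [DefinableFun f] [DefinableFun g],
      DefinablePred fun v => r (f v) (g v)]
    (hsymm : ∀ x y, mem x V → mem y V → r x y → r y x) :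
    ∃ g : M → M, (∀ x y, mem x V → mem y V → g x = g y → x = y) ∧
      (∀ x y, mem x V → mem y V → (DAdj (g x) (g y) ↔ r x y)) ∧
      (∀ x z, mem x V → DAdj (g x) z → ∃ y, mem y V ∧ z = g y) ∧
      (∀ x, mem x V → ¬ mem (g x) B) ∧
      ∃ C, ∀ z, mem z C ↔ ∃ x, mem x V ∧ z = g x := by
  obtain ⟨c, hc, hctrans⟩ := hM.exists_transitive (hM.upair V B)
  have hVc : ∀ x, mem x V → mem x c := fun x hx =>
    hctrans _ _ (hctrans _ _ hc (hM.mem_upair.2 (.inl rfl))) hx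
  have hBc : ∀ x, mem x B → mem x c := fun x hx =>
    hctrans _ _ (hctrans _ _ hc (hM.mem_upair.2 (.inr rfl))) hx
  obtain ⟨u, huc, hu⟩ := hM.exists_subset_not_mem c
  -- The label of `x` is `{x, u}`. As `u` is not in the transitive set `c`, neither is the label.
  have hlc : ∀ x, ¬ mem (hM.upair x u) c := fun x h =>
    hu (hctrans _ _ h (hM.mem_upair.2 (.inr rfl)))
  have hlu : ∀ x, hM.upair x u ≠ u := fun x h => by
    have hmem : mem u (hM.upair x u) := hM.mem_upair.2 (.inr rfl)
    rw [h] at hmem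
    exact hu (huc u hmem)
  have hll : ∀ x y, mem x V → ¬ mem (hM.upair y u) (hM.upair x u) := fun x y hx h => by
    rcases hM.mem_upair.1 h with h | h
    · exact hlc y (h ▸ hVc x hx)
    · exact hlu y h
  have hlll : ∀ x y z, mem x V → mem (hM.upair y u) z → ¬ mem z (hM.upair x u) := by
    intro x y z hx hyz hz
    rcases hM.mem_upair.1 hz with rfl | rfl
    · exact hlc y (hctrans _ _ (hVc z hx) hyz)
    · exact hlc y (huc _ hyz)
  have hinj : ∀ x y, mem x V → hM.upair x u = hM.upair y u → x = y := by
    intro x y hx h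
    rcases hM.upair_eq_upair_iff.1 h with h | h
    · exact h.1
    · exact (hu (h.1 ▸ hVc x hx)).elim
  obtain ⟨g, hg, hC⟩ := hM.exists_solution V r (fun x => hM.upair x u) (hr := @hr)
    (hl := fun _ _ => inferInstance) fun x _ h => hlc x (hVc _ h)
  have hlg : ∀ x, mem x V → mem (hM.upair x u) (g x) := fun x hx => (hg x hx _).2 (.inr rfl)
  have hgl : ∀ x y, mem x V → mem y V → g y ≠ hM.upair x u := fun x y hx hy h =>
    hll x y hx (h ▸ hlg y hy)
  have hginj : ∀ x y, mem x V → mem y V → g x = g y → x = y := by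
    intro x y hx hy h
    rcases (hg y hy _).1 (h ▸ hlg x hx) with ⟨z, hz, -, h⟩ | h
    · exact (hgl x z hx hz h.symm).elim
    · exact hinj x y hx h
  have hmem : ∀ x y, mem x V → mem y V → (mem (g y) (g x) ↔ r x y) := by
    intro x y hx hy
    rw [hg x hx]
    constructor
    · rintro (⟨z, hz, hxz, h⟩ | h)
      · rwa [hginj y z hy hz h]
      · exact (hgl x y hx hy h).elim
    · exact fun h => .inl ⟨y, hy, h, rfl⟩
  refine ⟨g, hginj, fun x y hx hy => ?_, fun x z hx hz => ?_, fun x hx h => ?_, hC⟩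
  · rw [DAdj, hmem y x hy hx, hmem x y hx hy]
    exact ⟨And.right, fun h => ⟨hsymm x y hx hy h, h⟩⟩
  · rcases (hg x hx z).1 hz.2 with ⟨y, hy, -, rfl⟩ | rfl
    · exact ⟨y, hy, rfl⟩
    · exact (hlll x x _ hx (hlg x hx) hz.1).elim
  · exact hlc x (hctrans _ _ (hBc _ h) (hlg x hx))

end SetTheory

/-! ### Back-and-forth systems for binary relations -/

section BackAndForth

universe u v u' v'

variable {X : Type u} {Y : Type v}

/-- The pairs in `R` form a partial isomorphism between `(X, E)` and `(Y, F)`. -/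
def IsPartialIso (E : X → X → Prop) (F : Y → Y → Prop) (R : Set (X × Y)) : Prop :=
  ∀ p ∈ R, ∀ q ∈ R, (p.1 = q.1 ↔ p.2 = q.2) ∧ (E p.1 q.1 ↔ F p.2 q.2)

/-- Duplicator wins the Ehrenfeucht–Fraïssé game with `k` rounds between `(A, E)` and `(B, F)` from
the position in which the pairs in `R` have been chosen. -/
def BackForth (E : X → X → Prop) (F : Y → Y → Prop) (A : Set X) (B : Set Y) :
    ℕ → Set (X × Y) → Prop
  | 0, R => IsPartialIso E F R
  | k + 1, R => IsPartialIso E F R ∧ (∀ c ∈ A, ∃ d ∈ B, BackForth E F A B k (insert (c, d) R)) ∧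
      ∀ d ∈ B, ∃ c ∈ A, BackForth E F A B k (insert (c, d) R)

variable {E : X → X → Prop} {F : Y → Y → Prop} {A A' : Set X} {B B' : Set Y}

theorem BackForth.isPartialIso {k : ℕ} {R : Set (X × Y)} (h : BackForth E F A B k R) :
    IsPartialIso E F R := by
  cases k with
  | zero => exact h
  | succ k => exact h.1

theorem BackForth.of_succ {k : ℕ} {R : Set (X × Y)} (h : BackForth E F A B (k + 1) R) :
    BackForth E F A B k R := by
  induction k generalizing R with
  | zero => exact h.1
  | succ k ih =>
    refine ⟨h.1, fun c hc => ?_, fun d hd => ?_⟩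
    · exact (h.2.1 c hc).imp fun d => And.imp_right ih
    · exact (h.2.2 d hd).imp fun c => And.imp_right ih

theorem BackForth.symm {k : ℕ} {R : Set (X × Y)} (h : BackForth E F A B k R) :
    BackForth F E B A k (Prod.swap ⁻¹' R) := by
  have hiso : ∀ {R}, IsPartialIso E F R → IsPartialIso F E (Prod.swap ⁻¹' R) :=
    fun h p hp q hq => ⟨(h _ hp _ hq).1.symm, (h _ hp _ hq).2.symm⟩
  have hins : ∀ (R : Set (X × Y)) c d,
      Prod.swap ⁻¹' (insert (c, d) R) = insert (d, c) (Prod.swap ⁻¹' R) := by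
    intro R c d
    ext ⟨y, x⟩
    simp [and_comm]
  induction k generalizing R with
  | zero => exact hiso h
  | succ k ih =>
    refine ⟨hiso h.1, fun d hd => ?_, fun c hc => ?_⟩
    · exact (h.2.2 d hd).imp fun c hc => ⟨hc.1, hins R c d ▸ ih hc.2⟩
    · exact (h.2.1 c hc).imp fun d hd => ⟨hd.1, hins R c d ▸ ih hd.2⟩

theorem IsPartialIso.union {R R' : Set (X × Y)} (h : IsPartialIso E F R) (h' : IsPartialIso E F R')
    (hR : R ⊆ A ×ˢ B) (hR' : R' ⊆ A' ×ˢ B')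
    (hA : ∀ x ∈ A, ∀ y ∈ A', x ≠ y ∧ ¬ E x y ∧ ¬ E y x)
    (hB : ∀ x ∈ B, ∀ y ∈ B', x ≠ y ∧ ¬ F x y ∧ ¬ F y x) : IsPartialIso E F (R ∪ R') := by
  rintro p (hp | hp) q (hq | hq)
  · exact h p hp q hq
  · have h1 := hA _ (hR hp).1 _ (hR' hq).1
    have h2 := hB _ (hR hp).2 _ (hR' hq).2
    exact ⟨iff_of_false h1.1 h2.1, iff_of_false h1.2.1 h2.2.1⟩
  · have h1 := hA _ (hR hq).1 _ (hR' hp).1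
    have h2 := hB _ (hR hq).2 _ (hR' hp).2
    exact ⟨iff_of_false h1.1.symm h2.1.symm, iff_of_false h1.2.2 h2.2.2⟩
  · exact h' p hp q hq

/-- Winning strategies on two pairs of structures combine to one on the disjoint unions. -/
theorem BackForth.union {k : ℕ} {R R' : Set (X × Y)} (h : BackForth E F A B k R)
    (h' : BackForth E F A' B' k R') (hR : R ⊆ A ×ˢ B) (hR' : R' ⊆ A' ×ˢ B')
    (hA : ∀ x ∈ A, ∀ y ∈ A', x ≠ y ∧ ¬ E x y ∧ ¬ E y x)
    (hB : ∀ x ∈ B, ∀ y ∈ B', x ≠ y ∧ ¬ F x y ∧ ¬ F y x) :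
    BackForth E F (A ∪ A') (B ∪ B') k (R ∪ R') := by
  have hiso := h.isPartialIso.union h'.isPartialIso hR hR' hA hB
  induction k generalizing R R' with
  | zero => exact hiso
  | succ k ih =>
    have left : ∀ c ∈ A, ∀ d ∈ B, BackForth E F A B k (insert (c, d) R) →
        BackForth E F (A ∪ A') (B ∪ B') k (insert (c, d) (R ∪ R')) := fun c hc d hd hcd => by
      have hR1 : insert (c, d) R ⊆ A ×ˢ B := Set.insert_subset ⟨hc, hd⟩ hR
      rw [← Set.insert_union]
      exact ih hcd h'.of_succ hR1 hR' (hcd.isPartialIso.union h'.isPartialIso hR1 hR' hA hB)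
    have right : ∀ c ∈ A', ∀ d ∈ B', BackForth E F A' B' k (insert (c, d) R') →
        BackForth E F (A ∪ A') (B ∪ B') k (insert (c, d) (R ∪ R')) := fun c hc d hd hcd => by
      have hR1 : insert (c, d) R' ⊆ A' ×ˢ B' := Set.insert_subset ⟨hc, hd⟩ hR'
      rw [← Set.union_insert]
      exact ih h.of_succ hcd hR hR1 (h.isPartialIso.union hcd.isPartialIso hR hR1 hA hB)
    refine ⟨hiso, ?_, ?_⟩
    · rintro c (hc | hc)
      · obtain ⟨d, hd, hcd⟩ := h.2.1 c hc
        exact ⟨d, .inl hd, left c hc d hd hcd⟩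
      · obtain ⟨d, hd, hcd⟩ := h'.2.1 c hc
        exact ⟨d, .inr hd, right c hc d hd hcd⟩
    · rintro d (hd | hd)
      · obtain ⟨c, hc, hcd⟩ := h.2.2 d hd
        exact ⟨c, .inl hc, left c hc d hd hcd⟩
      · obtain ⟨c, hc, hcd⟩ := h'.2.2 d hd
        exact ⟨c, .inr hc, right c hc d hd hcd⟩

/-- The binary relation of a structure for the language of graphs. -/
def Adj {V : Type*} [Language.graph.Structure V] (x y : V) : Prop :=
  Language.Structure.RelMap Language.adj ![x, y]

theorem exists_eq_var {n : ℕ} (t : Language.graph.Term (Empty ⊕ Fin n)) :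
    ∃ i, t = .var (.inr i) := by
  rcases t with (_ | i) | f
  · contradiction
  · exact ⟨i, rfl⟩
  · cases f

theorem realize_rel_adj {V α : Type*} [Language.graph.Structure V] {n : ℕ} {v : α → V}
    (i : Fin 2 → Fin n) (x : Fin n → V) :
    (Language.BoundedFormula.rel Language.adj fun j => .var (.inr (i j))).Realize v x ↔
      Adj (x (i 0)) (x (i 1)) := by
  refine iff_of_eq (congrArg (Language.Structure.RelMap Language.adj) (funext fun j => ?_))
  fin_cases j <;> rfl

/-- If Duplicator wins the game with sufficiently many rounds, then the chosen points satisfy the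
same instances of a given formula. -/
theorem exists_realize_iff_of_backForth [Language.graph.Structure X] [Language.graph.Structure Y]
    {n : ℕ} (φ : Language.graph.BoundedFormula Empty n) :
    ∃ k, ∀ (R : Set (X × Y)) (v : Fin n → X) (w : Fin n → Y),
      BackForth Adj Adj Set.univ Set.univ k R → (∀ i, (v i, w i) ∈ R) →
      (φ.Realize default v ↔ φ.Realize default w) := by
  induction φ with
  | falsum => exact ⟨0, fun _ _ _ _ _ => Iff.rfl⟩
  | equal s t =>
    obtain ⟨i, rfl⟩ := exists_eq_var s
    obtain ⟨j, rfl⟩ := exists_eq_var t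
    exact ⟨0, fun R v w h hvw => (h _ (hvw i) _ (hvw j)).1⟩
  | rel r ts =>
    cases r
    choose i hi using fun j => exists_eq_var (ts j)
    obtain rfl : ts = _ := funext hi
    exact ⟨0, fun R v w h hvw => (realize_rel_adj i v).trans
      ((h _ (hvw (i 0)) _ (hvw (i 1))).2.trans (realize_rel_adj i w).symm)⟩
  | imp φ ψ ih₁ ih₂ =>
    obtain ⟨k₁, h₁⟩ := ih₁
    obtain ⟨k₂, h₂⟩ := ih₂
    have mono : ∀ {R : Set (X × Y)} {k l}, BackForth Adj Adj Set.univ Set.univ (k + l) R →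
        BackForth Adj Adj Set.univ Set.univ k R := by
      intro R k l h
      induction l with
      | zero => exact h
      | succ l ih => exact ih h.of_succ
    exact ⟨k₁ + k₂, fun R v w h hvw =>
      imp_congr (h₁ R v w (mono h) hvw) (h₂ R v w (mono (Nat.add_comm k₁ k₂ ▸ h)) hvw)⟩
  | all φ ih =>
    obtain ⟨k, hk⟩ := ih
    have key : ∀ {R : Set (X × Y)} {v w} {c : X} {d : Y},
        BackForth Adj Adj Set.univ Set.univ k (insert (c, d) R) → (∀ i, (v i, w i) ∈ R) →
        (φ.Realize default (Fin.snoc v c : Fin _ → X) ↔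
          φ.Realize default (Fin.snoc w d : Fin _ → Y)) := by
      refine fun {R v w c d} hcd hvw => hk _ _ _ hcd fun i => ?_
      induction i using Fin.lastCases with
      | last => simp
      | cast i => simpa using .inr (hvw i)
    refine ⟨k + 1, fun R v w h hvw => ⟨fun hφ d => ?_, fun hφ c => ?_⟩⟩
    · obtain ⟨c, -, hcd⟩ := h.2.2 d trivial
      exact (key hcd hvw).1 (hφ c)
    · obtain ⟨d, -, hcd⟩ := h.2.1 c trivial
      exact (key hcd hvw).2 (hφ d)

/-! ### Hintikka formulas -/

/-- The quantifier-free types of `n`-tuples in a set with a binary relation: equality of the entries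
and the relation between them. -/
abbrev AtomicType (n : ℕ) : Type := (Fin n → Fin n → Prop) × (Fin n → Fin n → Prop)

/-- The types of rank `k` of `n`-tuples in a set with a binary relation. A type of rank `k + 1`
consists of a quantifier-free type and of the set of types of rank `k` of the extensions by one
further entry. -/
def RankType : ℕ → ℕ → Type
  | 0, n => AtomicType n
  | k + 1, n => AtomicType n × Set (RankType k (n + 1))

instance RankType.finite (k n : ℕ) : Finite (RankType k n) := by
  induction k generalizing n with
  | zero => exact inferInstanceAs (Finite (AtomicType n))
  | succ k ih =>
    have := ih (n + 1)
    exact inferInstanceAs (Finite (AtomicType n × Set (RankType k (n + 1))))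

/-- The quantifier-free type of a tuple. -/
def atomicType (E : X → X → Prop) {n : ℕ} (a : Fin n → X) : AtomicType n :=
  (fun i j => a i = a j, fun i j => E (a i) (a j))

/-- The type of rank `k` of a tuple. -/
def rankType (E : X → X → Prop) : (k : ℕ) → {n : ℕ} → (Fin n → X) → RankType k n
  | 0, _, a => atomicType E a
  | k + 1, _, a => (atomicType E a, {t | ∃ c, rankType E k (Fin.snoc a c : Fin _ → X) = t})

theorem isPartialIso_of_atomicType_eq {X' : Type u'} {Y' : Type v'} {f : X' → X} {g : Y' → Y}
    (hf : Function.Injective f) (hg : Function.Injective g) {n : ℕ} {a : Fin n → X'}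
    {b : Fin n → Y'}
    (h : atomicType (fun x y => E (f x) (f y)) a = atomicType (fun x y => F (g x) (g y)) b) :
    IsPartialIso E F (Set.range fun i => (f (a i), g (b i))) := by
  rintro _ ⟨i, rfl⟩ _ ⟨j, rfl⟩
  have h1 := congrFun (congrFun (congrArg Prod.fst h) i) j
  have h2 := congrFun (congrFun (congrArg Prod.snd h) i) j
  exact ⟨by rw [hf.eq_iff, hg.eq_iff]; exact iff_of_eq h1, iff_of_eq h2⟩

/-- Duplicator wins the game with `k` rounds from tuples of the same type of rank `k`. The two
structures are given by injections `f` and `g` onto the sets on which the game is played. -/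
theorem backForth_of_rankType_eq {X' : Type u'} {Y' : Type v'} {f : X' → X} {g : Y' → Y}
    (hf : Function.Injective f) (hg : Function.Injective g) {k n : ℕ} {a : Fin n → X'}
    {b : Fin n → Y'}
    (h : rankType (fun x y => E (f x) (f y)) k a = rankType (fun x y => F (g x) (g y)) k b) :
    BackForth E F (Set.range f) (Set.range g) k (Set.range fun i => (f (a i), g (b i))) := by
  induction k generalizing n with
  | zero => exact isPartialIso_of_atomicType_eq hf hg h
  | succ k ih =>
    have key : ∀ c d, rankType (fun x y => E (f x) (f y)) k (Fin.snoc a c : Fin _ → X') =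
        rankType (fun x y => F (g x) (g y)) k (Fin.snoc b d : Fin _ → Y') →
        BackForth E F (Set.range f) (Set.range g) k
          (insert (f c, g d) (Set.range fun i => (f (a i), g (b i)))) := by
      intro c d hcd
      convert ih hcd using 1
      ext p
      simp [Fin.exists_fin_succ', or_comm, eq_comm]
    refine ⟨isPartialIso_of_atomicType_eq hf hg (congrArg Prod.fst h), ?_, ?_⟩
    · rintro _ ⟨c, rfl⟩
      obtain ⟨d, hd⟩ := (Set.ext_iff.1 (congrArg Prod.snd h) _).1 ⟨c, rfl⟩
      exact ⟨g d, ⟨d, rfl⟩, key c d hd.symm⟩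
    · rintro _ ⟨d, rfl⟩
      obtain ⟨c, hc⟩ := (Set.ext_iff.1 (congrArg Prod.snd h) _).2 ⟨d, rfl⟩
      exact ⟨f c, ⟨c, rfl⟩, key c d hc⟩

open Classical in
/-- The formula that defines a quantifier-free type. -/
noncomputable def atomicFormula {n : ℕ} (t : AtomicType n) :
    Language.graph.BoundedFormula Empty n :=
  (Language.BoundedFormula.iInf fun p : Fin n × Fin n =>
    if t.1 p.1 p.2 then (Language.Term.var (.inr p.1)).bdEqual (.var (.inr p.2))
    else ((Language.Term.var (.inr p.1)).bdEqual (.var (.inr p.2))).not) ⊓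
  Language.BoundedFormula.iInf fun p : Fin n × Fin n =>
    if t.2 p.1 p.2 then Language.adj.boundedFormula₂ (.var (.inr p.1)) (.var (.inr p.2))
    else (Language.adj.boundedFormula₂ (.var (.inr p.1)) (.var (.inr p.2))).not

open Classical in
/-- The formula that defines a type of rank `k`. -/
noncomputable def hintikkaFormula :
    (k : ℕ) → {n : ℕ} → RankType k n → Language.graph.BoundedFormula Empty n
  | 0, _, t => atomicFormula t
  | k + 1, n, t => atomicFormula t.1 ⊓ Language.BoundedFormula.iInf fun s : RankType k (n + 1) =>
      if s ∈ t.2 then (hintikkaFormula k s).ex else (hintikkaFormula k s).ex.not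

theorem realize_atomicFormula [Language.graph.Structure X] {n : ℕ} (t : AtomicType n)
    (a : Fin n → X) : (atomicFormula t).Realize default a ↔ atomicType Adj a = t := by
  classical
  have h : ∀ P Q : Prop, (if P then Q else ¬ Q) ↔ (Q = P) := by
    intro P Q
    by_cases hP : P <;> simp [hP]
  rw [atomicFormula, Language.BoundedFormula.realize_inf, Language.BoundedFormula.realize_iInf,
    Language.BoundedFormula.realize_iInf, Prod.ext_iff, funext_iff, funext_iff, Prod.forall,
    Prod.forall]
  refine and_congr ?_ ?_
  all_goals
    refine forall_congr' fun i => ?_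
    rw [funext_iff]
    refine forall_congr' fun j => ?_
    rw [← h]
    split_ifs <;> simp [atomicType, Adj]

theorem realize_hintikkaFormula [Language.graph.Structure X] {k n : ℕ} (t : RankType k n)
    (a : Fin n → X) : (hintikkaFormula k t).Realize default a ↔ rankType Adj k a = t := by
  induction k generalizing n with
  | zero => exact realize_atomicFormula t a
  | succ k ih =>
    rw [hintikkaFormula, Language.BoundedFormula.realize_inf, realize_atomicFormula,
      Language.BoundedFormula.realize_iInf]
    obtain ⟨t, T⟩ : AtomicType n × Set (RankType k (n + 1)) := t
    refine (and_congr_right fun _ => ?_).trans (Prod.mk_inj (a₁ := atomicType Adj a) (a₂ := t)).symm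
    rw [Set.ext_iff]
    refine forall_congr' fun s => ?_
    have : (hintikkaFormula k s).ex.Realize default a ↔
        ∃ c, rankType Adj k (Fin.snoc a c : Fin _ → X) = s := by
      simp only [Language.BoundedFormula.realize_ex, ih]
    split_ifs with hs
    · simpa [hs] using this
    · simpa [hs] using this.not

end BackAndForth

/-! ### Elementary equivalence of double-membership graphs -/

section ElementaryEquivalence

universe u v

variable {M : Type u} {N : Type v} [memLang.Structure M] [memLang.Structure N]

/-- The structure for the language of graphs given by a binary relation. -/
@[reducible]
def graphStructure {V : Type*} (E : V → V → Prop) : Language.graph.Structure V where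
  funMap := Empty.elim
  RelMap {_} r := match r with
    | .adj => fun v => E (v 0) (v 1)

theorem realize_symmetric {V : Type*} [Language.graph.Structure V] :
    V ⊨ (Language.adj.symmetric : Language.graph.Sentence) ↔ ∀ x y : V, Adj x y → Adj y x :=
  Language.Relations.realize_symmetric.trans ⟨fun h => h.symm, fun h => ⟨h⟩⟩

/-- A set of a model is closed under double membership, that is, it is a union of connected
components of the double-membership graph. -/
def IsDClosed (a : M) : Prop := ∀ x y, mem x a → DAdj x y → mem y a

/-- A graph of `M` with a distinguished vertex has a copy in the double-membership graph of `N`, up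
to equivalence for the game with `k` rounds, if `N` satisfies all consistency statements that `M`
satisfies: its type of rank `k` is described by a sentence. -/
theorem IsModel.exists_backForth (hM : IsModel M) (hN : IsModel N)
    (hcon : ∀ φ : Language.graph.Sentence, ModelsCon M φ → ModelsCon N φ) (k : ℕ) {a c : M}
    (hc : mem c a) (B : N) :
    ∃ b d : N, mem d b ∧ IsDClosed b ∧ (∀ y, mem y b → ¬ mem y B) ∧
      BackForth DAdj DAdj {x | mem x a} {y | mem y b} k {(c, d)} := by
  let E : {x : M // mem x a} → {x : M // mem x a} → Prop := fun x y => DAdj (x : M) (y : M)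
  let t : RankType k 1 := rankType E k (fun _ => ⟨c, hc⟩)
  obtain ⟨b, S, -, ⟨hrel, -⟩, hS⟩ := hcon (Language.adj.symmetric ⊓ (hintikkaFormula k t).ex) <| by
    refine ⟨a, graphStructure E, ⟨c, hc⟩, ⟨fun n R => ?_, fun n f => f.elim⟩, ?_⟩
    · cases R
      exact hM.isInternalRel a fun v : Fin 2 → M => DAdj (v 0) (v 1)
    · let := graphStructure E
      rw [Language.Sentence.Realize, Language.Formula.realize_inf]
      refine ⟨realize_symmetric.2 fun x y h => h.symm, ?_⟩
      refine Language.BoundedFormula.realize_ex.2 ⟨⟨c, hc⟩, ?_⟩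
      refine (realize_hintikkaFormula t _).2 (congrArg (rankType E k) (Fin.snoc_zero _ _))
  rw [Language.Sentence.Realize, Language.Formula.realize_inf] at hS
  obtain ⟨hsymm, hS⟩ := hS
  replace hsymm := realize_symmetric.1 hsymm
  obtain ⟨d, hd⟩ := Language.BoundedFormula.realize_ex.1 hS
  rw [realize_hintikkaFormula] at hd
  obtain ⟨ρ, hρ⟩ := hrel 2 Language.adj
  have hadj : ∀ x y : {x : N // mem x b}, mem (hN.tuple ![(x : N), (y : N)]) ρ ↔ Adj x y := by
    intro x y
    simp only [hρ, hN.isTuple_iff]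
    constructor
    · rintro ⟨v, hv, h⟩
      have h' := hN.tuple_injective h
      obtain rfl : v = ![x, y] := by
        funext i
        have := congrFun h' i
        fin_cases i <;> exact Subtype.ext this.symm
      exact hv
    · refine fun h => ⟨_, h, congrArg _ (funext fun i => ?_)⟩
      fin_cases i <;> rfl
  obtain ⟨g, hginj, hgadj, hgcl, hgB, C, hC⟩ := hN.exists_realization b B
    (fun x y => mem (hN.tuple ![x, y]) ρ) (hr := fun f g _ _ => by
      have : ∀ i, DefinableFun fun v => (![f v, g v] : Fin 2 → N) i := fun i => by
        fin_cases i
        · exact inferInstanceAs (DefinableFun f)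
        · exact inferInstanceAs (DefinableFun g)
      infer_instance) fun x y hx hy h =>
        (hadj ⟨y, hy⟩ ⟨x, hx⟩).2 (hsymm _ _ ((hadj ⟨x, hx⟩ ⟨y, hy⟩).1 h))
  refine ⟨C, g d, (hC _).2 ⟨d, d.2, rfl⟩, fun x y hx hxy => ?_, fun y hy hyB => ?_, ?_⟩
  · obtain ⟨x, hxb, rfl⟩ := (hC _).1 hx
    exact (hC _).2 (hgcl x y hxb hxy)
  · obtain ⟨x, hx, rfl⟩ := (hC _).1 hy
    exact hgB x hx hyB
  · have key := backForth_of_rankType_eq (E := DAdj) (F := DAdj)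
      (f := fun x : {x : M // mem x a} => (x : M)) (g := fun y : {y : N // mem y b} => g y)
      (k := k) (a := fun _ : Fin 1 => ⟨c, hc⟩) (b := fun _ : Fin 1 => d) Subtype.val_injective
      (fun x y h => Subtype.ext (hginj x y x.2 y.2 h)) <| by
        have hF : (fun x y : {y : N // mem y b} => DAdj (g x) (g y)) = Adj := by
          funext x y
          exact propext ((hgadj x y x.2 y.2).trans (hadj x y))
        rw [hF]
        exact hd.symm.trans (congrArg _ (Fin.snoc_zero _ _))
    convert key using 1
    · ext x
      simp
    · ext y
      simp [hC, eq_comm]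
    · ext p
      simp

/-- One move of Duplicator. A point outside the current set `a` lies in a set `a'` disjoint from `a`
and closed under double membership, and a copy of `a'` disjoint from `b` provides the answer. -/
theorem IsModel.exists_backForth_insert (hM : IsModel M) (hN : IsModel N)
    (hcon : ∀ φ : Language.graph.Sentence, ModelsCon M φ → ModelsCon N φ) {k : ℕ} {a : M} {b : N}
    (ha : IsDClosed a) (hb : IsDClosed b) {R : Set (M × N)}
    (hR : R ⊆ {x | mem x a} ×ˢ {y | mem y b})
    (h : BackForth DAdj DAdj {x | mem x a} {y | mem y b} (k + 1) R) (c : M) :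
    ∃ (a' : M) (b' d : N), IsDClosed a' ∧ IsDClosed b' ∧
      insert (c, d) R ⊆ {x | mem x a'} ×ˢ {y | mem y b'} ∧
      BackForth DAdj DAdj {x | mem x a'} {y | mem y b'} k (insert (c, d) R) := by
  by_cases hc : mem c a
  · obtain ⟨d, hd, hcd⟩ := h.2.1 c hc
    exact ⟨a, b, d, ha, hb, Set.insert_subset ⟨hc, hd⟩ hR, hcd⟩
  obtain ⟨T, hcT, hT⟩ := hM.exists_transitive c
  obtain ⟨a₁, ha₁⟩ := hM.exists_sep T fun x => ¬ mem x a
  have hca₁ : mem c a₁ := (ha₁ c).2 ⟨hcT, hc⟩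
  have hcl₁ : IsDClosed a₁ := fun x y hx hxy => by
    obtain ⟨hxT, hxa⟩ := (ha₁ x).1 hx
    exact (ha₁ y).2 ⟨hT x y hxT hxy.2, fun hy => hxa (ha y x hy hxy.symm)⟩
  obtain ⟨b₁, d, hd, hbcl₁, hbb₁, hcd⟩ := hM.exists_backForth hN hcon k hca₁ b
  obtain ⟨a', ha'⟩ := hM.exists_union a a₁
  obtain ⟨b', hb'⟩ := hN.exists_union b b₁
  have hea : {x | mem x a'} = {x | mem x a} ∪ {x | mem x a₁} := Set.ext ha'
  have heb : {y | mem y b'} = {y | mem y b} ∪ {y | mem y b₁} := Set.ext hb'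
  refine ⟨a', b', d, fun x y hx hxy => ?_, fun x y hx hxy => ?_, Set.insert_subset ?_ ?_, ?_⟩
  · exact (ha' y).2 (((ha' x).1 hx).imp (fun h => ha x y h hxy) fun h => hcl₁ x y h hxy)
  · exact (hb' y).2 (((hb' x).1 hx).imp (fun h => hb x y h hxy) fun h => hbcl₁ x y h hxy)
  · exact ⟨(ha' c).2 (.inr hca₁), (hb' d).2 (.inr hd)⟩
  · exact fun p hp => ⟨(ha' _).2 (.inl (hR hp).1), (hb' _).2 (.inl (hR hp).2)⟩
  · rw [hea, heb, ← Set.union_singleton]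
    refine h.of_succ.union hcd hR (Set.singleton_subset_iff.2 ⟨hca₁, hd⟩) ?_ ?_
    · refine fun x hx y hy => ⟨?_, fun hxy => ?_, fun hyx => ?_⟩
      · rintro rfl
        exact ((ha₁ x).1 hy).2 hx
      · exact ((ha₁ y).1 hy).2 (ha x y hx hxy)
      · exact ((ha₁ y).1 hy).2 (ha x y hx hyx.symm)
    · refine fun x hx y hy => ⟨?_, fun hxy => ?_, fun hyx => ?_⟩
      · rintro rfl
        exact hbb₁ x hy hx
      · exact hbb₁ y hy (hb x y hx hxy)
      · exact hbb₁ y hy (hb x y hx hyx.symm)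

/-- Duplicator wins the game on the double-membership graphs from a position in which she wins the
game on two sets that are closed under double membership. -/
theorem IsModel.backForth_univ (hM : IsModel M) (hN : IsModel N)
    (hcon : ∀ φ : Language.graph.Sentence, ModelsCon M φ ↔ ModelsCon N φ) {k : ℕ} {a : M} {b : N}
    (ha : IsDClosed a) (hb : IsDClosed b) {R : Set (M × N)}
    (hR : R ⊆ {x | mem x a} ×ˢ {y | mem y b})
    (h : BackForth DAdj DAdj {x | mem x a} {y | mem y b} k R) :
    BackForth DAdj DAdj Set.univ Set.univ k R := by
  induction k generalizing a b R with
  | zero => exact h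
  | succ k ih =>
    refine ⟨h.1, fun c _ => ?_, fun d _ => ?_⟩
    · obtain ⟨a', b', d, ha', hb', hR', h'⟩ :=
        hM.exists_backForth_insert hN (fun φ => (hcon φ).1) ha hb hR h c
      exact ⟨d, trivial, ih ha' hb' hR' h'⟩
    · obtain ⟨b', a', c, hb', ha', hR', h'⟩ := hN.exists_backForth_insert hM
        (fun φ => (hcon φ).2) hb ha (fun p hp => ⟨(hR hp).2, (hR hp).1⟩) h.symm d
      have hswap : Prod.swap ⁻¹' insert (d, c) (Prod.swap ⁻¹' R) = insert (c, d) R := by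
        ext ⟨x, y⟩
        simp [and_comm]
      refine ⟨c, trivial, ih ha' hb' (fun p hp => ?_) (hswap ▸ h'.symm)⟩
      rw [← hswap] at hp
      exact ⟨(hR' hp).2, (hR' hp).1⟩

theorem IsModel.elementarilyEquivalent (hM : IsModel M) (hN : IsModel N)
    (hcon : ∀ φ : Language.graph.Sentence, ModelsCon M φ ↔ ModelsCon N φ) :
    DGraph M ≅[Language.graph] DGraph N := by
  rw [Language.elementarilyEquivalent_iff]
  intro φ
  obtain ⟨k, hk⟩ := exists_realize_iff_of_backForth (X := DGraph M) (Y := DGraph N) φ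
  have hempty : BackForth DAdj DAdj {x | mem x hM.empty} {y | mem y hN.empty} k ∅ := by
    cases k with
    | zero => exact fun p hp => hp.elim
    | succ k =>
      exact ⟨fun p hp => hp.elim, fun c hc => (hM.not_mem_empty c hc).elim,
        fun d hd => (hN.not_mem_empty d hd).elim⟩
  exact hk ∅ default default (hM.backForth_univ hN hcon
    (fun x _ hx => (hM.not_mem_empty x hx).elim) (fun x _ hx => (hN.not_mem_empty x hx).elim)
    (Set.empty_subset _) hempty) fun i => i.elim0

end ElementaryEquivalence

/-! ### Interpreting structures for a finite language in graphs -/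

section Coding

universe u v

variable {L : FirstOrder.Language.{0, 0}}

/-- The number of arguments of the relation that a symbol stands for: for a function symbol this is
its graph, with the value as the first argument. -/
def arity : L.Symbols → ℕ
  | .inl f => f.1 + 1
  | .inr R => R.1

/-- The relation that a symbol stands for. -/
def Holds {A : Type*} (S : L.Structure A) : (s : L.Symbols) → (Fin (arity s) → A) → Prop
  | .inl f, v => S.funMap f.2 (Fin.tail v) = v (0 : Fin (f.1 + 1))
  | .inr R, v => S.RelMap R.2 v

/-- For each symbol `s`, a kind of vertices for the tuples that satisfy `s` (the index `none`), and,
for each argument `i` of `s`, a kind of vertices joining these tuples to their entries at `i`. -/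
abbrev Cell (L : FirstOrder.Language.{0, 0}) : Type := Σ s : L.Symbols, Option (Fin (arity s))

/-- In a graph with a hub `h c` for each kind `c` of vertices, which is adjacent to the vertices of
this kind, the tuple `v` satisfies the relation coded for the symbol `s`. -/
def Coded {X : Type*} (E : X → X → Prop) (h : Cell L → X) (s : L.Symbols)
    (v : Fin (arity s) → X) : Prop :=
  ∃ t, E t (h ⟨s, none⟩) ∧ ∀ i, ∃ e, E e (h ⟨s, some i⟩) ∧ E e t ∧ E e (v i)

/-- The structure `S` on `A` is coded in the graph `(X, E)` with hubs `h`: its domain is identified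
by `j` with the set of vertices with a loop. -/
structure IsCoding {A : Type u} {X : Type v} (S : L.Structure A) (E : X → X → Prop)
    (h : Cell L → X) (j : A → X) : Prop where
  injective : Function.Injective j
  loop_iff : ∀ x, E x x ↔ ∃ b, j b = x
  holds_iff : ∀ s v, Holds S s v ↔ Coded E h s fun i => j (v i)

/-- The coded relation for a function symbol is the graph of the function. -/
theorem IsCoding.coded_iff {A : Type u} {X : Type v} [S : L.Structure A] {E : X → X → Prop}
    {h : Cell L → X} {j : A → X}
    (hj : IsCoding S E h j) (f : Σ n, L.Functions n) (v : Fin f.1 → A) (b : A) :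
    Coded E h (.inl f) (Fin.cons (j b) fun i => j (v i) : Fin (f.1 + 1) → X) ↔
      S.funMap f.2 v = b := by
  refine Iff.trans (iff_of_eq (congrArg (Coded E h (.inl f)) ?_))
    (hj.holds_iff (.inl f) (Fin.cons b v : Fin (f.1 + 1) → A)).symm
  exact funext (Fin.cases rfl fun _ => rfl)

/-- The atomic formula saying that two variables are adjacent. -/
def adjFormula {β : Type} (x y : β) : Language.graph.Formula β :=
  Language.adj.formula₂ (.var x) (.var y)

/-- The formula saying that the relation coded for `s` holds. -/
noncomputable def codedFormula {β : Type} (h : Cell L → β) (s : L.Symbols)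
    (v : Fin (arity s) → β) : Language.graph.Formula β :=
  (adjFormula (.inr ()) (.inl (h ⟨s, none⟩)) ⊓ Language.Formula.iInf fun i =>
    (adjFormula (.inr ()) (.inl (.inl (h ⟨s, some i⟩))) ⊓
      (adjFormula (.inr ()) (.inl (.inr ())) ⊓
        adjFormula (.inr ()) (.inl (.inl (v i))))).iExs Unit).iExs Unit

/-- The formula saying that `y` is a vertex with a loop and is a value, according to the relation
coded for the function symbol `f`, at the arguments `v`. -/
noncomputable def valueFormula {β : Type} (h : Cell L → β) (f : Σ n, L.Functions n) (y : β)
    (v : Fin f.1 → β) : Language.graph.Formula β :=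
  adjFormula y y ⊓ codedFormula h (.inl f) (Fin.cons y v : Fin (f.1 + 1) → β)

/-- The formula saying that `y` is the value of a term. -/
noncomputable def termFormula {γ : Type} : L.Term γ → {β : Type} → (Cell L → β) → (γ → β) → β →
    Language.graph.Formula β
  | .var a, _, _, ρ, y => (Language.Term.var y).equal (.var (ρ a))
  | @Language.Term.func _ _ n f ts, _, h, ρ, y =>
    ((Language.Formula.iInf fun i =>
        termFormula (ts i) (fun c => .inl (h c)) (fun a => .inl (ρ a)) (.inr i)) ⊓
      valueFormula (fun c => .inl (h c)) ⟨n, f⟩ (.inl y) .inr).iExs (Fin n)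

/-- The translation of a formula about a structure into one about a graph that codes it. -/
noncomputable def graphFormula : {n : ℕ} → L.BoundedFormula Empty n → {β : Type} → (Cell L → β) →
    (Fin n → β) → Language.graph.Formula β
  | _, .falsum, _, _, _ => ⊥
  | _, .equal s t, _, h, ρ =>
    (termFormula s (fun c => .inl (h c)) (fun a => .inl (Sum.elim Empty.elim ρ a)) (.inr ()) ⊓
      termFormula t (fun c => .inl (h c)) (fun a => .inl (Sum.elim Empty.elim ρ a))
        (.inr ())).iExs Unit
  | _, .rel (l := l) R ts, _, h, ρ =>
    ((Language.Formula.iInf fun i => termFormula (ts i) (fun c => .inl (h c))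
        (fun a => .inl (Sum.elim Empty.elim ρ a)) (.inr i)) ⊓
      codedFormula (fun c => .inl (h c)) (.inr ⟨l, R⟩) (Sum.inr : Fin l → _)).iExs (Fin l)
  | _, .imp φ ψ, _, h, ρ => (graphFormula φ h ρ).imp (graphFormula ψ h ρ)
  | n, .all φ, β, h, ρ =>
    ((adjFormula (.inr ()) (.inr ())).imp (graphFormula φ (fun c => .inl (h c))
      (Fin.snoc (fun i => .inl (ρ i)) (.inr ()) : Fin (n + 1) → β ⊕ Unit))).iAlls Unit

/-- The formula saying that the relation coded for a function symbol is the graph of a function on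
the vertices with a loop. -/
noncomputable def functionFormula {β : Type} (h : Cell L → β) (f : Σ n, L.Functions n) :
    Language.graph.Formula β :=
  let hasUniqueValue : Language.graph.Formula (β ⊕ Fin f.1) :=
    (valueFormula (fun c => .inl (.inl (h c))) f (.inr ()) (fun i => .inl (.inr i)) ⊓
      ((valueFormula (fun c => .inl (.inl (.inl (h c)))) f (.inr ())
        fun i => .inl (.inl (.inr i))).imp
          ((Language.Term.var (.inr ())).equal (.var (.inl (.inr ()))))).iAlls Unit).iExs Unit
  ((Language.Formula.iInf fun i => adjFormula (.inr i) (.inr i)).imp hasUniqueValue).iAlls (Fin f.1)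

/-- The sentence about symmetric graphs saying that the graph codes a nonempty structure that
satisfies `φ`. -/
noncomputable def graphSentence [Finite L.Symbols] (φ : L.Sentence) : Language.graph.Sentence :=
  Language.adj.symmetric ⊓
    ((Language.Formula.iInf fun f : L.Symbols => match f with
        | .inl f => functionFormula Sum.inr f
        | .inr _ => ⊤) ⊓
      ((adjFormula (.inr ()) (.inr ()) : Language.graph.Formula ((Empty ⊕ Cell L) ⊕ Unit)).iExs
        Unit ⊓ graphFormula φ Sum.inr Fin.elim0) :
          Language.graph.Formula (Empty ⊕ Cell L)).iExs (Cell L)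

variable {A : Type u} {X : Type v} [Language.graph.Structure X]

theorem realize_adjFormula {β : Type} (x y : β) (w : β → X) :
    (adjFormula x y).Realize w ↔ Adj (w x) (w y) :=
  Language.Formula.realize_rel₂

theorem realize_codedFormula {β : Type} (h : Cell L → β) (s : L.Symbols) (v : Fin (arity s) → β)
    (w : β → X) :
    (codedFormula h s v).Realize w ↔ Coded Adj (fun c => w (h c)) s fun i => w (v i) := by
  simp only [codedFormula, Language.Formula.realize_iExs, Language.Formula.realize_inf,
    Language.Formula.realize_iInf, realize_adjFormula, Sum.elim_inl, Sum.elim_inr, Coded]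
  exact ⟨fun ⟨t, ht, hv⟩ => ⟨t (), ht, fun i => let ⟨e, he⟩ := hv i; ⟨e (), he⟩⟩,
    fun ⟨t, ht, hv⟩ => ⟨fun _ => t, ht, fun i => let ⟨e, he⟩ := hv i; ⟨fun _ => e, he⟩⟩⟩

theorem realize_valueFormula {β : Type} (h : Cell L → β) (f : Σ n, L.Functions n) (y : β)
    (v : Fin f.1 → β) (w : β → X) :
    (valueFormula h f y v).Realize w ↔ Adj (w y) (w y) ∧
      Coded Adj (fun c => w (h c)) (.inl f)
        (Fin.cons (w y) fun i => w (v i) : Fin (f.1 + 1) → X) := by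
  rw [valueFormula, Language.Formula.realize_inf, realize_adjFormula]
  refine and_congr_right fun _ => (realize_codedFormula h (.inl f) _ w).trans
    (iff_of_eq (congrArg (Coded Adj _ (.inl f)) ?_))
  exact funext (Fin.cases rfl fun _ => rfl)

namespace IsCoding

variable [S : L.Structure A] {j : A → X}

theorem realize_termFormula {γ β : Type} (t : L.Term γ) {h : Cell L → β} {ρ : γ → β} {y : β}
    {w : β → X} {v : γ → A} (hj : IsCoding S Adj (fun c => w (h c)) j)
    (hv : ∀ a, w (ρ a) = j (v a)) :
    (termFormula t h ρ y).Realize w ↔ w y = j (t.realize v) := by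
  induction t generalizing β with
  | var a => simp [termFormula, Language.Formula.realize_equal, hv]
  | @func n f ts ih =>
    simp only [termFormula, Language.Formula.realize_iExs, Language.Formula.realize_inf,
      Language.Formula.realize_iInf, realize_valueFormula, Sum.elim_inl, Sum.elim_inr]
    have key : ∀ (x : Fin n → X) i, (termFormula (ts i) (fun c => .inl (h c))
        (fun a => .inl (ρ a)) (.inr i)).Realize (Sum.elim w x) ↔ x i = j ((ts i).realize v) :=
      fun x i => ih i (w := Sum.elim w x) hj hv
    simp only [key]
    constructor
    · rintro ⟨x, hx, hy, hc⟩
      obtain ⟨b, hb⟩ := (hj.loop_iff _).1 hy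
      obtain rfl : x = _ := funext hx
      rw [← hb] at hc ⊢
      exact congrArg j ((hj.coded_iff ⟨n, f⟩ _ b).1 hc).symm
    · intro hy
      refine ⟨_, fun i => rfl, (hj.loop_iff _).2 ⟨_, hy.symm⟩, ?_⟩
      rw [hy]
      exact (hj.coded_iff ⟨n, f⟩ _ _).2 rfl

theorem realize_graphFormula {n : ℕ} (φ : L.BoundedFormula Empty n) {β : Type} {h : Cell L → β}
    {ρ : Fin n → β} {w : β → X} {v : Fin n → A} (hj : IsCoding S Adj (fun c => w (h c)) j)
    (hv : ∀ i, w (ρ i) = j (v i)) :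
    (graphFormula φ h ρ).Realize w ↔ φ.Realize default v := by
  have hterm : ∀ {n} {ρ : Fin n → β} {v : Fin n → A}, (∀ i, w (ρ i) = j (v i)) → ∀ {κ : Type}
      (x : κ → X) (t : L.Term (Empty ⊕ Fin n)) k,
      (termFormula t (fun c => .inl (h c)) (fun a => .inl (Sum.elim Empty.elim ρ a))
        (.inr k)).Realize (Sum.elim w x) ↔ x k = j (t.realize (Sum.elim default v)) := by
    intro n ρ v hv κ x t k
    refine realize_termFormula t (w := Sum.elim w x) (v := Sum.elim default v) hj ?_
    rintro (a | i)
    · exact a.elim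
    · exact hv i
  induction φ generalizing β with
  | falsum => exact Iff.rfl
  | equal s t =>
    simp only [graphFormula, Language.Formula.realize_iExs, Language.Formula.realize_inf, hterm hv,
      Language.BoundedFormula.Realize]
    exact ⟨fun ⟨x, hs, ht⟩ => hj.injective (hs.symm.trans ht),
      fun h => ⟨fun _ => _, rfl, congrArg j h⟩⟩
  | @rel n l R ts =>
    simp only [graphFormula, Language.Formula.realize_iExs, Language.Formula.realize_inf,
      Language.Formula.realize_iInf, hterm hv,
      Language.BoundedFormula.Realize]
    have key := hj.holds_iff (.inr ⟨l, R⟩) fun i => (ts i).realize (Sum.elim default v)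
    constructor
    · rintro ⟨x, hx, hc⟩
      obtain rfl : x = _ := funext hx
      exact key.2 ((realize_codedFormula _ (.inr ⟨l, R⟩) _ _).1 hc)
    · exact fun h => ⟨_, fun i => rfl, (realize_codedFormula _ (.inr ⟨l, R⟩) _ _).2 (key.1 h)⟩
  | imp φ ψ ih₁ ih₂ =>
    simp only [graphFormula, Language.Formula.realize_imp, Language.BoundedFormula.realize_imp,
      ih₁ hj hv hterm, ih₂ hj hv hterm]
  | @all n φ ih =>
    simp only [graphFormula, Language.Formula.realize_iAlls, Language.Formula.realize_imp,
      realize_adjFormula, Sum.elim_inr, Language.BoundedFormula.realize_all]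
    have key : ∀ (x : Unit → X) b, x () = j b →
        ((graphFormula φ (fun c => .inl (h c)) (Fin.snoc (fun i => .inl (ρ i)) (.inr ()) :
          Fin (n + 1) → β ⊕ Unit)).Realize (Sum.elim w x) ↔
            φ.Realize default (Fin.snoc v b : Fin (n + 1) → A)) := by
      intro x b hb
      have hv' : ∀ i, Sum.elim w x ((Fin.snoc (fun i => .inl (ρ i)) (.inr ()) :
          Fin (n + 1) → β ⊕ Unit) i) = j ((Fin.snoc v b : Fin (n + 1) → A) i) := by
        intro i
        induction i using Fin.lastCases with
        | last => simpa using hb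
        | cast i => simpa using hv i
      refine ih (w := Sum.elim w x) hj hv' fun {n ρ' v'} hv' κ x' t k => ?_
      refine realize_termFormula t (w := Sum.elim (Sum.elim w x) x') (v := Sum.elim default v')
        hj ?_
      rintro (a | i)
      · exact a.elim
      · exact hv' i
    constructor
    · exact fun hφ b => (key (fun _ => j b) b rfl).1 (hφ _ ((hj.loop_iff _).2 ⟨b, rfl⟩))
    · intro hφ x hx
      obtain ⟨b, hb⟩ := (hj.loop_iff _).1 hx
      exact (key x b hb.symm).2 (hφ b)

end IsCoding

theorem realize_functionFormula {β : Type} (h : Cell L → β) (f : Σ n, L.Functions n) (w : β → X) :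
    (functionFormula h f).Realize w ↔ ∀ v : Fin f.1 → X, (∀ i, Adj (v i) (v i)) →
      ∃ y, (Adj y y ∧ Coded Adj (fun c => w (h c)) (.inl f) (Fin.cons y v : Fin (f.1 + 1) → X)) ∧
        ∀ z, Adj z z ∧ Coded Adj (fun c => w (h c)) (.inl f) (Fin.cons z v : Fin (f.1 + 1) → X) →
          z = y := by
  simp only [functionFormula, Language.Formula.realize_iAlls, Language.Formula.realize_iExs,
    Language.Formula.realize_imp, Language.Formula.realize_inf, Language.Formula.realize_iInf,
    realize_adjFormula, realize_valueFormula, Language.Formula.realize_equal,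
    Language.Term.realize_var, Sum.elim_inl, Sum.elim_inr]
  exact forall_congr' fun v => imp_congr_right fun _ =>
    ⟨fun ⟨y, hy, hz⟩ => ⟨y (), hy, fun z hz' => hz (fun _ => z) hz'⟩,
      fun ⟨y, hy, hz⟩ => ⟨fun _ => y, hy, fun z hz' => hz (z ()) hz'⟩⟩

theorem realize_graphSentence [Finite L.Symbols] (φ : L.Sentence) :
    X ⊨ graphSentence φ ↔ (∀ x y : X, Adj x y → Adj y x) ∧ ∃ h : Cell L → X,
      (∀ f, (functionFormula Sum.inr f).Realize (Sum.elim default h : Empty ⊕ Cell L → X)) ∧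
      (∃ x : X, Adj x x) ∧
      (graphFormula φ Sum.inr Fin.elim0).Realize (Sum.elim default h : Empty ⊕ Cell L → X) := by
  rw [Language.Sentence.Realize, graphSentence, Language.Formula.realize_inf,
    Language.Formula.realize_iExs]
  refine and_congr realize_symmetric (exists_congr fun h => ?_)
  rw [Language.Formula.realize_inf, Language.Formula.realize_inf, Language.Formula.realize_iInf,
    Language.Formula.realize_iExs]
  simp only [realize_adjFormula, Sum.elim_inr]
  refine and_congr ⟨fun hf f => hf (.inl f), fun hf => ?_⟩ (and_congr_left fun _ => ?_)
  · rintro (f | R)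
    · exact hf f
    · exact Language.Formula.realize_top.2 trivial
  · exact ⟨fun ⟨x, hx⟩ => ⟨x (), hx⟩, fun ⟨x, hx⟩ => ⟨fun _ => x, hx⟩⟩

/-- A symmetric graph that codes a nonempty structure satisfying `φ` satisfies the translation. -/
theorem IsCoding.realize_graphSentence [Finite L.Symbols] {φ : L.Sentence} [S : L.Structure A]
    [Nonempty A] {h : Cell L → X} {j : A → X} (hj : IsCoding S Adj h j)
    (hsymm : ∀ x y : X, Adj x y → Adj y x) (hφ : A ⊨ φ) : X ⊨ graphSentence φ := by
  refine (ZFA.realize_graphSentence φ).2 ⟨hsymm, h, fun f => ?_, ?_, ?_⟩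
  · refine (realize_functionFormula _ f _).2 fun v hv => ?_
    choose b hb using fun i => (hj.loop_iff _).1 (hv i)
    obtain rfl : _ = v := funext hb
    refine ⟨j (S.funMap f.2 b), ⟨(hj.loop_iff _).2 ⟨_, rfl⟩, (hj.coded_iff f b _).2 rfl⟩,
      fun z hz => ?_⟩
    obtain ⟨y, rfl⟩ := (hj.loop_iff _).1 hz.1
    rw [(hj.coded_iff f b y).1 hz.2]
  · obtain ⟨b⟩ := ‹Nonempty A›
    exact ⟨j b, (hj.loop_iff _).2 ⟨b, rfl⟩⟩
  · exact (IsCoding.realize_graphFormula φ (w := Sum.elim default h) (v := default) hj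
      fun i => i.elim0).2 hφ

/-- A graph that satisfies the translation of `φ` codes a nonempty structure satisfying `φ`. -/
theorem exists_isCoding [Finite L.Symbols] {φ : L.Sentence} {j : A → X} (hφ : X ⊨ graphSentence φ)
    (hinj : Function.Injective j) (hloop : ∀ x : X, Adj x x ↔ ∃ b, j b = x) :
    ∃ (h : Cell L → X) (S : L.Structure A), IsCoding S Adj h j ∧ Nonempty A ∧ A ⊨ φ := by
  obtain ⟨-, h, hf, ⟨x, hx⟩, hφ⟩ := (realize_graphSentence φ).1 hφ
  have hf' : ∀ (f : Σ n, L.Functions n) (v : Fin f.1 → A), ∃ b, ∀ y,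
      Coded Adj h (.inl f) (Fin.cons (j y) (fun i => j (v i)) : Fin (f.1 + 1) → X) ↔ b = y := by
    intro f v
    obtain ⟨y, ⟨hy, hc⟩, huniq⟩ := (realize_functionFormula _ f _).1 (hf f) (fun i => j (v i))
      fun i => (hloop _).2 ⟨_, rfl⟩
    obtain ⟨b, rfl⟩ := (hloop y).1 hy
    refine ⟨b, fun y => ⟨fun h => ?_, fun h => h ▸ hc⟩⟩
    exact (hinj (huniq (j y) ⟨(hloop _).2 ⟨_, rfl⟩, h⟩)).symm
  choose F hF using hf'
  let S : L.Structure A :=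
    { funMap := fun {n} f v => F ⟨n, f⟩ v
      RelMap := fun {n} R v => Coded Adj h (.inr ⟨n, R⟩) fun i => j (v i) }
  have hj : IsCoding S Adj h j := by
    refine ⟨hinj, hloop, ?_⟩
    rintro (f | R) v
    · refine (hF f (Fin.tail v) (v (0 : Fin (f.1 + 1)))).symm.trans
        (iff_of_eq (congrArg (Coded Adj h (.inl f)) ?_))
      exact funext (Fin.cases rfl fun _ => rfl)
    · exact Iff.rfl
  obtain ⟨b, -⟩ := (hloop x).1 hx
  exact ⟨h, S, hj, ⟨b⟩, (IsCoding.realize_graphFormula φ (w := Sum.elim default h) (v := default) hj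
    fun i => i.elim0).1 hφ⟩

end Coding

/-! ### Neighbourhoods in double-membership graphs -/

section Neighbourhoods

universe u v

theorem realize_relativize {X : Type u} [Language.graph.Structure X] {n : ℕ}
    (φ : Language.graph.BoundedFormula Empty n) (x : X) (v : Fin n → {y // Adj x y}) :
    (relativize φ).Realize default (Fin.cons x fun i => (v i : X) : Fin (n + 1) → X) ↔
      letI := graphStructure fun y z : {y // Adj x y} => Adj (y : X) (z : X)
      φ.Realize default v := by
  let := graphStructure fun y z : {y // Adj x y} => Adj (y : X) (z : X)
  induction φ with
  | falsum => exact Iff.rfl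
  | equal s t =>
    obtain ⟨i, rfl⟩ := exists_eq_var s
    obtain ⟨j, rfl⟩ := exists_eq_var t
    exact Subtype.ext_iff.symm
  | rel r ts =>
    cases r
    choose i hi using fun j => exists_eq_var (ts j)
    obtain rfl : ts = _ := funext hi
    exact (realize_rel_adj (fun j => (i j).succ) _).trans (realize_rel_adj i v).symm
  | imp φ ψ ih₁ ih₂ => exact imp_congr (ih₁ v) (ih₂ v)
  | @all n φ ih =>
    have key : ∀ y, (Language.adj.boundedFormula₂ (.var (.inr 0)) (.var (.inr (Fin.last (n + 1)))) :
        Language.graph.BoundedFormula Empty (n + 2)).Realize default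
          (Fin.snoc (Fin.cons x fun i => (v i : X) : Fin (n + 1) → X) y : Fin (n + 2) → X) ↔
        Adj x y := by
      intro y
      rw [Language.BoundedFormula.realize_rel₂, ← Fin.cons_snoc_eq_snoc_cons]
      simp [Adj, -Fin.succ_last]
    have ih' : ∀ y : {y // Adj x y}, (relativize φ).Realize default
        (Fin.snoc (Fin.cons x fun i => (v i : X) : Fin (n + 1) → X) (y : X) : Fin (n + 2) → X) ↔
        φ.Realize default (Fin.snoc v y : Fin (n + 1) → {y // Adj x y}) := by
      intro y
      refine Iff.trans ?_ (ih (Fin.snoc v y))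
      rw [← Fin.cons_snoc_eq_snoc_cons]
      refine iff_of_eq (congrArg _ (congrArg _ (funext fun i => ?_)))
      induction i using Fin.lastCases with
      | last => simp
      | cast i => simp
    constructor
    · exact fun h y => (ih' y).1 (h y ((key y).2 y.2))
    · exact fun h y hy => (ih' ⟨y, (key y).1 hy⟩).2 (h _)

variable {M : Type u} [memLang.Structure M]

theorem realize_mu (φ : Language.graph.Sentence) :
    DGraph M ⊨ mu φ ↔ ∃ x : M, ¬ DAdj x x ∧
      letI := graphStructure fun y z : {y : M // DAdj x y} => DAdj (y : M) (z : M)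
      {y : M // DAdj x y} ⊨ φ := by
  rw [Language.Sentence.Realize, mu]
  refine Language.BoundedFormula.realize_ex.trans (exists_congr fun x => ?_)
  rw [Language.BoundedFormula.realize_inf, Language.BoundedFormula.realize_not,
    Language.BoundedFormula.realize_rel₂]
  refine and_congr Iff.rfl (Iff.trans ?_ (realize_relativize (X := DGraph M) φ x default))
  refine iff_of_eq (congrArg _ (funext fun i => ?_))
  obtain rfl : i = 0 := Subsingleton.elim (α := Fin 1) _ _
  rfl

end Neighbourhoods

/-! ### Consistency statements and neighbourhoods -/

section Consistency

universe u

variable {M : Type u} [memLang.Structure M] {L : FirstOrder.Language.{0, 0}}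

theorem isInternalStructure_iff (a : M) (S : L.Structure {b : M // mem b a}) :
    IsInternalStructure a S ↔ ∀ s, IsInternalRel a (Holds S s) := by
  constructor
  · rintro ⟨hR, hf⟩ (f | R)
    · exact hf _ f.2
    · exact hR _ R.2
  · exact fun h => ⟨fun n R => h (.inr ⟨n, R⟩), fun n f => h (.inl ⟨n, f⟩)⟩

/-- If the neighbours of a point satisfy the translation of `φ`, then `φ` has a model in the sense
of `M`: the structure coded in the set of neighbours is definable, hence a set. -/
theorem IsModel.modelsCon_of_mu (hM : IsModel M) [Finite L.Symbols] {φ : L.Sentence}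
    (hφ : DGraph M ⊨ mu (graphSentence φ)) : ModelsCon M φ := by
  obtain ⟨x, -, hx⟩ := (realize_mu _).1 hφ
  let := graphStructure fun y z : {y : M // DAdj x y} => DAdj (y : M) (z : M)
  obtain ⟨a, ha⟩ := hM.exists_sep x fun y => DAdj x y ∧ DAdj y y
  obtain ⟨h, S, hj, ⟨b⟩, hS⟩ := exists_isCoding (A := {b : M // mem b a})
    (j := fun b => ⟨b, ((ha b).1 b.2).2.1⟩) hx
    (fun b c hbc => Subtype.ext (Subtype.mk.inj hbc)) fun y =>
      ⟨fun hy => ⟨⟨y, (ha y).2 ⟨y.2.2, y.2, hy⟩⟩, rfl⟩, by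
        rintro ⟨b, rfl⟩
        exact ((ha b).1 b.2).2.2⟩
  refine ⟨a, S, ⟨b, b.2⟩, (isInternalStructure_iff a S).2 fun s => ?_, hS⟩
  have : ∀ v, Holds S s v = ∃ t, (DAdj x t ∧ DAdj t (h ⟨s, none⟩ : M)) ∧ ∀ i, ∃ e, DAdj x e ∧
      DAdj e (h ⟨s, some i⟩ : M) ∧ DAdj e t ∧ DAdj e (v i : M) := by
    intro v
    rw [hj.holds_iff, Coded]
    refine propext ⟨?_, ?_⟩
    · rintro ⟨t, ht, hv⟩
      refine ⟨t, ⟨t.2, ht⟩, fun i => ?_⟩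
      obtain ⟨e, he⟩ := hv i
      exact ⟨e, e.2, he⟩
    · rintro ⟨t, ⟨ht, ht'⟩, hv⟩
      refine ⟨⟨t, ht⟩, ht', fun i => ?_⟩
      obtain ⟨e, he, he'⟩ := hv i
      exact ⟨⟨e, he⟩, he'⟩
  rw [show Holds S s = _ from funext this]
  exact hM.isInternalRel a fun v => ∃ t, (DAdj x t ∧ DAdj t (h ⟨s, none⟩ : M)) ∧ ∀ i, ∃ e,
    DAdj x e ∧ DAdj e (h ⟨s, some i⟩ : M) ∧ DAdj e t ∧ DAdj e (v i)

/-- Realization of a graph whose vertices are finitely many copies of the elements of a set `W`, the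
relation between any two copies being definable. -/
theorem IsModel.exists_realization_copies (hM : IsModel M) {K : Type} [Finite K] (W : M)
    (r : K → K → M → M → Prop)
    (hr : ∀ k l {α : Type} (f g : (α → M) → M) [DefinableFun f] [DefinableFun g],
      DefinablePred fun v => r k l (f v) (g v))
    (hsymm : ∀ k l x y, r k l x y → r l k y x) :
    ∃ g : K → M → M,
      (∀ k l x y, mem x W → mem y W → g k x = g l y → k = l ∧ x = y) ∧
      (∀ k l x y, mem x W → mem y W → (DAdj (g k x) (g l y) ↔ r k l x y)) ∧
      ∀ k x z, mem x W → DAdj (g k x) z → ∃ l y, mem y W ∧ z = g l y := by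
  -- The copies are told apart by distinct points `τ k` of the model: the copy of `x` of kind `k` is
  -- the pair of `τ k` and `x`.
  have := hM.infinite
  obtain ⟨m, ⟨e⟩⟩ := Finite.exists_equiv_fin K
  let τ : K → M := fun k => Infinite.natEmbedding M (e k)
  have hτ : ∀ k l, τ k = τ l → k = l := fun k l h =>
    e.injective (Fin.val_injective ((Infinite.natEmbedding M).injective h))
  obtain ⟨T, hT⟩ := hM.exists_range τ
  obtain ⟨V, hV⟩ := hM.exists_prod T W
  have hV' : ∀ k x, mem x W → mem (hM.pair (τ k) x) V := fun k x hx =>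
    (hV _).2 ⟨τ k, x, (hT _).2 ⟨k, rfl⟩, hx, rfl⟩
  let R : M → M → Prop := fun p q => ∃ k l : K, ∃ x y : M,
    p = hM.pair (τ k) x ∧ q = hM.pair (τ l) y ∧ r k l x y
  have hR : ∀ k l x y, R (hM.pair (τ k) x) (hM.pair (τ l) y) ↔ r k l x y := by
    intro k l x y
    constructor
    · rintro ⟨k', l', x', y', hp, hq, h⟩
      obtain ⟨hk, rfl⟩ := hM.pair_eq_pair_iff.1 hp
      obtain ⟨hl, rfl⟩ := hM.pair_eq_pair_iff.1 hq
      rwa [hτ _ _ hk, hτ _ _ hl]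
    · exact fun h => ⟨k, l, x, y, rfl, rfl, h⟩
  obtain ⟨g, hginj, hgadj, hgcl, -⟩ := hM.exists_realization V hM.empty R (hr := fun f g _ _ => by
      have := fun k l => @hr k l
      exact inferInstanceAs (DefinablePred fun v => ∃ k l : K, ∃ x y : M,
        f v = hM.pair (τ k) x ∧ g v = hM.pair (τ l) y ∧ r k l x y)) <| by
    rintro _ _ - - ⟨k, l, x, y, rfl, rfl, h⟩
    exact ⟨l, k, y, x, rfl, rfl, hsymm k l x y h⟩
  refine ⟨fun k x => g (hM.pair (τ k) x), fun k l x y hx hy h => ?_, fun k l x y hx hy => ?_,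
    fun k x z hx hz => ?_⟩
  · have := hM.pair_eq_pair_iff.1 (hginj _ _ (hV' k x hx) (hV' l y hy) h)
    exact ⟨hτ _ _ this.1, this.2⟩
  · rw [hgadj _ _ (hV' k x hx) (hV' l y hy), hR]
  · obtain ⟨p, hp, rfl⟩ := hgcl _ _ (hV' k x hx) hz
    obtain ⟨t, y, ht, hy, rfl⟩ := (hV p).1 hp
    obtain ⟨l, rfl⟩ := (hT t).1 ht
    exact ⟨l, y, hy, rfl⟩

/-- The kinds of vertices in the graph that codes a structure: the apex, whose neighbours are all
other vertices, the elements of the domain, the vertices for tuples and their entries, and the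
hubs. -/
inductive VertexKind (L : FirstOrder.Language.{0, 0}) : Type
  | apex
  | dom
  | cell (c : Cell L)
  | hub (c : Cell L)

instance [Finite L.Symbols] : Finite (VertexKind L) := by
  let f : VertexKind L → Option (Option (Cell L ⊕ Cell L)) := fun
    | .apex => none
    | .dom => some none
    | .cell c => some (some (.inl c))
    | .hub c => some (some (.inr c))
  refine Finite.of_injective f ?_
  rintro (_ | _ | c | c) (_ | _ | d | d) h <;> simp_all [f]

/-- The edges, each in one direction, of the graph that codes a structure with domain `a`, in which
`ρ s` is the set of tuples that satisfy the symbol `s`. The vertices are pairs consisting of a kind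
and a point of `M`. -/
def Edge (hM : IsModel M) (a : M) (ρ : L.Symbols → M) :
    VertexKind L → VertexKind L → M → M → Prop
  | .apex, l, _, _ => l ≠ .apex
  | .dom, l, x, y => l = .dom ∧ x = y ∧ mem x a
  | .cell ⟨_, none⟩, _, _, _ => False
  | .cell ⟨s, some i⟩, l, x, y =>
    (l = .dom ∧ ∃ v : Fin (arity s) → M, x = hM.tuple v ∧ y = v i) ∨ (l = .cell ⟨s, none⟩ ∧ x = y)
  | .hub c, l, _, y => l = .cell c ∧ mem y (ρ c.1)

theorem definablePred_edge (hM : IsModel M) (a : M) (ρ : L.Symbols → M) (k l : VertexKind L)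
    {α : Type} (f g : (α → M) → M) [DefinableFun f] [DefinableFun g] :
    DefinablePred fun v => Edge hM a ρ k l (f v) (g v) := by
  have hprop : ∀ p : Prop, DefinablePred fun _ : α → M => p := fun p => by
    by_cases h : p <;> simp only [h] <;> infer_instance
  rcases k with _ | _ | ⟨s, _ | i⟩ | c
  · exact hprop _
  · have := hprop (l = .dom)
    exact inferInstanceAs (DefinablePred fun v => l = .dom ∧ f v = g v ∧ mem (f v) a)
  · exact hprop _
  · have := hprop (l = .dom)
    have := hprop (l = .cell ⟨s, none⟩)
    exact inferInstanceAs (DefinablePred fun v => (l = .dom ∧ ∃ u : Fin (arity s) → M,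
      f v = hM.tuple u ∧ g v = u i) ∨ (l = .cell ⟨s, none⟩ ∧ f v = g v))
  · have := hprop (l = .cell c)
    exact inferInstanceAs (DefinablePred fun v => l = .cell c ∧ mem (g v) (ρ c.1))

/-- The adjacency relation of the graph that codes a structure. -/
def CodingAdj (hM : IsModel M) (a : M) (ρ : L.Symbols → M) (k l : VertexKind L) (x y : M) : Prop :=
  Edge hM a ρ k l x y ∨ Edge hM a ρ l k y x

section CodingAdj

variable (hM : IsModel M) (a : M) (ρ : L.Symbols → M) (x y : M)

theorem codingAdj_apex_iff (k : VertexKind L) : CodingAdj hM a ρ .apex k x y ↔ k ≠ .apex := by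
  rcases k with _ | _ | ⟨s, _ | i⟩ | c <;> simp [CodingAdj, Edge]

theorem codingAdj_self_iff (k : VertexKind L) :
    CodingAdj hM a ρ k k x x ↔ k = .dom ∧ mem x a := by
  rcases k with _ | _ | ⟨s, _ | i⟩ | c <;> simp [CodingAdj, Edge]

theorem codingAdj_hub_iff {k : VertexKind L} (hk : k ≠ .apex) (c : Cell L) :
    CodingAdj hM a ρ k (.hub c) x y ↔ k = .cell c ∧ mem x (ρ c.1) := by
  rcases k with _ | _ | ⟨s, _ | i⟩ | c' <;> simp_all [CodingAdj, Edge]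

theorem codingAdj_cell_none_iff (s : L.Symbols) (i : Fin (arity s)) :
    CodingAdj hM a ρ (.cell ⟨s, some i⟩) (.cell ⟨s, none⟩) x y ↔ x = y := by
  simp [CodingAdj, Edge]

theorem codingAdj_dom_iff (s : L.Symbols) (i : Fin (arity s)) :
    CodingAdj hM a ρ (.cell ⟨s, some i⟩) .dom x y ↔
      ∃ v : Fin (arity s) → M, x = hM.tuple v ∧ y = v i := by
  simp [CodingAdj, Edge]

end CodingAdj

/-- If `φ` has a model in the sense of `M`, then the neighbours of some point satisfy the
translation of `φ`. -/
theorem IsModel.mu_of_modelsCon (hM : IsModel M) [Finite L.Symbols] {φ : L.Sentence}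
    (hφ : ModelsCon M φ) : DGraph M ⊨ mu (graphSentence φ) := by
  obtain ⟨a, S, ⟨w, hw⟩, hS, hφ⟩ := hφ
  choose ρ hρ using (isInternalStructure_iff a S).1 hS
  simp only [hM.isTuple_iff] at hρ
  obtain ⟨W, haW, hρW⟩ : ∃ W, (∀ x, mem x a → mem x W) ∧ ∀ s x, mem x (ρ s) → mem x W := by
    obtain ⟨T, hT⟩ := hM.exists_range (fun s : Option L.Symbols => s.elim a ρ)
    obtain ⟨W, hW⟩ := hM.union T
    exact ⟨W, fun x hx => (hW x).2 ⟨a, (hT a).2 ⟨none, rfl⟩, hx⟩,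
      fun s x hx => (hW x).2 ⟨ρ s, (hT _).2 ⟨some s, rfl⟩, hx⟩⟩
  obtain ⟨g, hginj, hgadj, hgcl⟩ := hM.exists_realization_copies W (CodingAdj hM a ρ)
    (fun k l _ f g _ _ => by
      have h₁ := definablePred_edge hM a ρ k l f g
      have h₂ := definablePred_edge hM a ρ l k g f
      exact inferInstanceAs (DefinablePred fun v =>
        Edge hM a ρ k l (f v) (g v) ∨ Edge hM a ρ l k (g v) (f v))) fun _ _ _ _ => Or.symm
  have hwW := haW w hw
  have hapex : ∀ k x, k ≠ .apex → mem x W → DAdj (g .apex w) (g k x) := fun k x hk hx =>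
    (hgadj _ _ _ _ hwW hx).2 ((codingAdj_apex_iff ..).2 hk)
  have hnbr : ∀ z, DAdj (g .apex w) z → ∃ k x, k ≠ .apex ∧ mem x W ∧ z = g k x := fun z hz => by
    obtain ⟨k, x, hx, rfl⟩ := hgcl _ _ _ hwW hz
    exact ⟨k, x, (codingAdj_apex_iff ..).1 ((hgadj _ _ _ _ hwW hx).1 hz), hx, rfl⟩
  refine (realize_mu _).2 ⟨g .apex w, fun h =>
    (codingAdj_apex_iff ..).1 ((hgadj _ _ _ _ hwW hwW).1 h) rfl, ?_⟩
  let := graphStructure fun y z : {y : M // DAdj (g .apex w) y} => DAdj (y : M) (z : M)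
  have hne : ∀ c : Cell L, VertexKind.cell c ≠ .apex := nofun
  let h : Cell L → {y : M // DAdj (g .apex w) y} := fun c => ⟨g (.hub c) w, hapex _ _ nofun hwW⟩
  let j : {b : M // mem b a} → {y : M // DAdj (g .apex w) y} := fun b =>
    ⟨g .dom b, hapex _ _ nofun (haW b b.2)⟩
  have hhub : ∀ c z, DAdj (g .apex w) z → (DAdj z (g (.hub c) w) ↔
      ∃ x, mem x (ρ c.1) ∧ z = g (.cell c) x) := by
    intro c z hz
    constructor
    · intro hzc
      obtain ⟨k, x, hk, hx, rfl⟩ := hnbr z hz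
      obtain ⟨rfl, h⟩ := (codingAdj_hub_iff _ _ _ _ _ hk _).1 ((hgadj _ _ _ _ hx hwW).1 hzc)
      exact ⟨x, h, rfl⟩
    · rintro ⟨x, hx, rfl⟩
      exact (hgadj _ _ _ _ (hρW _ x hx) hwW).2 ((codingAdj_hub_iff _ _ _ _ _ (hne c) _).2 ⟨rfl, hx⟩)
  have hj : IsCoding S Adj h j := by
    refine ⟨fun b c hbc => Subtype.ext ?_, fun z => ⟨fun hz => ?_, ?_⟩,
      fun s v => ⟨fun hv => ?_, ?_⟩⟩
    · exact (hginj _ _ _ _ (haW b b.2) (haW c c.2) (Subtype.mk.inj hbc)).2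
    · obtain ⟨z, hz'⟩ := z
      obtain ⟨k, x, hk, hx, rfl⟩ := hnbr z hz'
      obtain ⟨rfl, hxa⟩ := (codingAdj_self_iff ..).1 ((hgadj _ _ _ _ hx hx).1 hz)
      exact ⟨⟨x, hxa⟩, rfl⟩
    · rintro ⟨b, rfl⟩
      exact (hgadj _ _ _ _ (haW b b.2) (haW b b.2)).2 ((codingAdj_self_iff ..).2 ⟨rfl, b.2⟩)
    · have ht := (hρ s _).2 ⟨v, hv, rfl⟩
      have htW := hρW s _ ht
      refine ⟨⟨g (.cell ⟨s, none⟩) _, hapex _ _ (hne _) htW⟩,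
        (hhub ⟨s, none⟩ _ (hapex _ _ (hne _) htW)).2 ⟨_, ht, rfl⟩, fun i => ?_⟩
      refine ⟨⟨g (.cell ⟨s, some i⟩) _, hapex _ _ (hne _) htW⟩,
        (hhub ⟨s, some i⟩ _ (hapex _ _ (hne _) htW)).2 ⟨_, ht, rfl⟩, ?_, ?_⟩
      · exact (hgadj _ _ _ _ htW htW).2 ((codingAdj_cell_none_iff ..).2 rfl)
      · exact (hgadj _ _ _ _ htW (haW _ (v i).2)).2 ((codingAdj_dom_iff ..).2 ⟨_, rfl, rfl⟩)
    · rintro ⟨⟨t, htx⟩, ht, hv⟩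
      obtain ⟨t₀, ht₀, rfl⟩ := (hhub ⟨s, none⟩ t htx).1 ht
      obtain ⟨v', hv', rfl⟩ := (hρ s t₀).1 ht₀
      have htW := hρW s _ ht₀
      suffices v' = v from this ▸ hv'
      funext i
      obtain ⟨⟨e, hex⟩, he, het, hev⟩ := hv i
      obtain ⟨t₁, ht₁, rfl⟩ := (hhub ⟨s, some i⟩ e hex).1 he
      have htW₁ := hρW s _ ht₁
      obtain rfl := (codingAdj_cell_none_iff ..).1 ((hgadj _ _ _ _ htW₁ htW).1 het)
      obtain ⟨v₁, h₁, h₂⟩ :=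
        (codingAdj_dom_iff ..).1 ((hgadj _ _ _ _ htW₁ (haW _ (v i).2)).1 hev)
      exact Subtype.ext ((congrFun (hM.tuple_injective h₁) i).trans h₂.symm)
  have : Nonempty {b : M // mem b a} := ⟨⟨w, hw⟩⟩
  exact hj.realize_graphSentence (fun x y hxy => hxy.symm) hφ

theorem graphSentence_mem_Phi [Finite L.Symbols] (φ : L.Sentence) : graphSentence φ ∈ Phi := by
  refine Language.Theory.models_sentence_iff.2 fun N => ?_
  have : (N : Type) ⊨ graphSentence φ := Language.Theory.realize_sentence_of_mem
    ({graphSentence φ} : Language.graph.Theory) (Set.mem_singleton _)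
  exact realize_symmetric.2 ((realize_graphSentence φ).1 this).1

end Consistency

end ZFA

theorem mainTheorem2 {M : Type*} {N : Type*} [ZFA.memLang.Structure M] [ZFA.memLang.Structure N]
    (hM : ZFA.IsModel M) (hN : ZFA.IsModel N) :
    List.TFAE [
      ZFA.DGraph M ≅[FirstOrder.Language.graph] ZFA.DGraph N,
      ∀ φ ∈ ZFA.Phi, ZFA.DGraph M ⊨ ZFA.mu φ ↔ ZFA.DGraph N ⊨ ZFA.mu φ,
      ∀ (L : FirstOrder.Language.{0, 0}) [Finite L.Symbols] (φ : L.Sentence),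
        ZFA.ModelsCon M φ ↔ ZFA.ModelsCon N φ] := by
  tfae_have 1 → 2 := fun h φ _ => h.realize_sentence (ZFA.mu φ)
  tfae_have 2 → 3 := fun h L _ φ => by
    have := h _ (ZFA.graphSentence_mem_Phi φ)
    exact ⟨fun hφ => hN.modelsCon_of_mu (this.1 (hM.mu_of_modelsCon hφ)),
      fun hφ => hM.modelsCon_of_mu (this.2 (hN.mu_of_modelsCon hφ))⟩
  tfae_have 3 → 1 := fun h => by
    have : Finite FirstOrder.Language.graph.Symbols := by
      have : Finite (Σ n, FirstOrder.Language.graph.Functions n) :=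
        have : IsEmpty (Σ n, FirstOrder.Language.graph.Functions n) := ⟨fun f => f.2.elim⟩
        inferInstance
      have : Finite (Σ n, FirstOrder.Language.graph.Relations n) := by
        refine @Finite.of_subsingleton _ ⟨?_⟩
        rintro ⟨_, ⟨⟩⟩ ⟨_, ⟨⟩⟩
        rfl
      exact Finite.instSum
    exact hM.elementarilyEquivalent hN (h FirstOrder.Language.graph)
  tfae_finish
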